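/- **Setting.** Let $N\ge 0$, $M\ge 1$, $T>0$. Agents $j\in\{1,\dots,N\}$ move on $\mathbb{R}$ by $\dot s_j=u_j$ from given positions $s_j(0)$; the admissible set $\mathcal U^N$ consists of all $u=(u_1,\dots,u_N)$ with each $u_j:[0,T]\to[-1,1]$ measurable. Targets $i\in\{1,\dots,M\}$ have given positions $\vartheta_i(t)$ and velocities $\dot\vartheta_i(t)$ with $\dot\vartheta_i$ integrable and $\vartheta_i(t)=\vartheta_i(0)+\int_0^t\dot\vartheta_i(\tau)\,d\tau$ on $[0,T]$. With sensing ranges $r_j>0$ put $$p_{ij}(x,y)=\max\{0,1-|x-y|/r_j\},\qquad P_i(t)=1-\prod_{j}\bigl(1-p_{ij}(\vartheta_i(t),s_j(t))\bigr).$$ For given $B_i>A_i>0$ and $R_i(0)\ge 0$, the uncertainty $R_i\ge 0$ of target $i$ is the absolutely continuous solution on $[0,T]$ (in the almost everywhere sense) of $\dot R_i=0$ if $R_i=0$ and $A_i<B_iP_i(t)$, and $\dot R_i=A_i-B_iP_i(t)$ otherwise. The optimal control problem is to minimize $$J(u)=\frac1T\int_0^T\sum_{i=1}^M R_i(t)\,dt\quad\text{over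 } u\in\mathcal U^N .$$ **Assumptions.** (i) $|\dot\vartheta_i(t)|\le 1$ for all $i$ and $t\in[0,T]$; (ii) there is $\Delta^{\min}>0$ with $|\vartheta_{i_1}(t)-\vartheta_{i_2}(t)|\ge 2\max_j r_j+\Delta^{\min}$ for all $i_1\ne i_2$ and $t\in[0,T]$. **Parameter space.** Let $n=\lceil 2T/\Delta^{\min}\rceil$. For each agent $j$ let $\mathcal Y_j$ be the set of all $(i,\bar t,\check t,\hat t,s)\in\{1,\dots,M\}^n\times(\mathbb{R}^n)^4$ with $$\bar t_{\ell-1}\le\check t_\ell\le\hat t_\ell\le\bar t_\ell,\qquad |s_\ell-s_0|\le\bar t_\ell\qquad(1\le\ell\le n),$$ where $\bar t_0=0$, $\bar t_n=T$, $s_0=s_j(0)$; let $\mathcal Y=\mathcal Y_1\times\dots\times\mathcal Y_N$. For $\pi\in\mathcal Y$ let $H(\pi)$ be the control whose $j$-th component, formed with the $j$-th component $(i,\bar t,\check t,\hat t,s)$ of $\pi$, is $$H(\pi)_j(t)=\begin{cases}\operatorname{sgn}\bigl(\vartheta_{i_\ell}(\bar t_{\ell-1})-s_{\ell-1}\bigr),&t\in[\bar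 t_{\ell-1},\check t_\ell),\\ \dot\vartheta_{i_\ell}(t),&t\in[\check t_\ell,\hat t_\ell),\\ \operatorname{sgn}\bigl(s_\ell-\vartheta_{i_\ell}(\bar t_\ell)\bigr),&t\in[\hat t_\ell,\bar t_\ell),\end{cases}\qquad 1\le\ell\le n,$$ and $H(\pi)_j(T)=0$, where $\operatorname{sgn}(0)=0$. **Theorem.** Under the assumptions (i) and (ii), every $u\in\mathcal U^N$ determines exactly one uncertainty trajectory on $[0,T]$ (so that $J(u)$ is well defined), the parameter space $\mathcal Y$ is compact, $H$ maps $\mathcal Y$ into $\mathcal U^N$, and there are an optimal control $u^*\in\mathcal U^N$, that is, $J(u^*)\le J(u)$ for all $u\in\mathcal U^N$, and a parameter $\pi^*\in\mathcal Y$ such that $H(\pi^*)=u^*$. -/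

import Mathlib

open MeasureTheory

noncomputable section

/-- The data of a one-dimensional persistent monitoring problem with `N` agents and `M` mobile
targets on the time interval `[0, T]`.  The target velocities are only assumed integrable, and a
target position is an indefinite integral of its velocity; in particular targets that are
differentiable with bounded velocity are covered. -/
structure MonitoringProblem (N M : ℕ) where
  /-- mission time -/
  T : ℝ
  T_pos : 0 < T
  /-- initial agent positions `s_j(0)` -/
  s₀ : Fin N → ℝ
  /-- sensing ranges -/
  r : Fin N → ℝ
  r_pos : ∀ j, 0 < r j
  /-- uncertainty growth rates -/
  A : Fin M → ℝ
  A_pos : ∀ i, 0 < A i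
  /-- uncertainty reduction rates -/
  B : Fin M → ℝ
  A_lt_B : ∀ i, A i < B i
  /-- initial uncertainties `R_i(0)` -/
  R₀ : Fin M → ℝ
  R₀_nonneg : ∀ i, 0 ≤ R₀ i
  /-- target positions -/
  pos : Fin M → ℝ → ℝ
  /-- target velocities -/
  vel : Fin M → ℝ → ℝ
  vel_integrable : ∀ i, IntervalIntegrable (vel i) volume 0 T
  pos_eq : ∀ i, ∀ t ∈ Set.Icc 0 T, pos i t = pos i 0 + ∫ τ in (0 : ℝ)..t, vel i τ

namespace MonitoringProblem

variable {N M : ℕ} (P : MonitoringProblem N M)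

/-- Targets are no faster than the agents, and two different targets are always at distance at
least `2 max_j r_j + Δ`. -/
structure Assumptions (Δ : ℝ) : Prop where
  speed : ∀ i, ∀ t ∈ Set.Icc 0 P.T, |P.vel i t| ≤ 1
  separated : ∀ i₁ i₂, i₁ ≠ i₂ → ∀ t ∈ Set.Icc 0 P.T, ∀ j,
    2 * P.r j + Δ ≤ |P.pos i₁ t - P.pos i₂ t|

/-! ### The optimal control problem -/

/-- The admissible controls of all agents: (Lebesgue) measurable functions on `[0, T]` with values
in `[-1, 1]`.  Values outside `[0, T]` play no role. -/
def admissible : Set (Fin N → ℝ → ℝ) :=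
  {u | ∀ j, AEMeasurable (u j) (volume.restrict (Set.Icc 0 P.T)) ∧
    ∀ t ∈ Set.Icc 0 P.T, |u j t| ≤ 1}

/-- Agent positions: the solution of `ṡ_j = u_j` with the given initial position. -/
def agentPos (u : Fin N → ℝ → ℝ) (j : Fin N) (t : ℝ) : ℝ :=
  P.s₀ j + ∫ τ in (0 : ℝ)..t, u j τ

/-- Monitoring function of an agent with sensing range `ρ` at `y` for a target at `x`. -/
def monitoring (ρ x y : ℝ) : ℝ := max 0 (1 - |x - y| / ρ)

/-- Joint monitoring function for a target at `x` and agents at `s`. -/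
def jointMonitoring (x : ℝ) (s : Fin N → ℝ) : ℝ :=
  1 - ∏ j, (1 - monitoring (P.r j) x (s j))

/-- Right-hand side of the uncertainty dynamics of target `i`, at uncertainty level `ρ`, target
position `x` and agent positions `s`. -/
def uncertaintyRate (i : Fin M) (ρ x : ℝ) (s : Fin N → ℝ) : ℝ :=
  if ρ = 0 ∧ P.A i < P.B i * P.jointMonitoring x s then 0
  else P.A i - P.B i * P.jointMonitoring x s

/-- `R` is a nonnegative Carathéodory solution on `[0, T]` of the uncertainty dynamics under the
control `u`, with the given initial uncertainties. -/
def IsUncertainty (u : Fin N → ℝ → ℝ) (R : Fin M → ℝ → ℝ) : Prop :=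
  ∀ i, (∀ t ∈ Set.Icc 0 P.T, 0 ≤ R i t) ∧
    IntervalIntegrable
      (fun τ => P.uncertaintyRate i (R i τ) (P.pos i τ) (fun j => P.agentPos u j τ))
      volume 0 P.T ∧
    ∀ t ∈ Set.Icc 0 P.T, R i t = P.R₀ i +
      ∫ τ in (0 : ℝ)..t, P.uncertaintyRate i (R i τ) (P.pos i τ) (fun j => P.agentPos u j τ)

/-- The cost: time average of the total uncertainty. -/
def cost (R : Fin M → ℝ → ℝ) : ℝ := 1 / P.T * ∫ t in (0 : ℝ)..P.T, ∑ i, R i t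

/-- `u` is a (global) solution of the optimal control problem. -/
def IsOptimal (u : Fin N → ℝ → ℝ) : Prop :=
  u ∈ P.admissible ∧ ∃ R, P.IsUncertainty u R ∧
    ∀ u' ∈ P.admissible, ∀ R', P.IsUncertainty u' R' → P.cost R ≤ P.cost R'

/-! ### The finite-dimensional parameterization -/

/-- Number of phases per agent. -/
def numPhases (Δ : ℝ) : ℕ := ⌈2 * P.T / Δ⌉₊

/-- Parameters of one agent with `n` phases: target indices `i_ℓ`, phase end times `t̄_ℓ`,
switching times `ť_ℓ` and `t̂_ℓ`, and switching positions `s_ℓ`, where `ℓ = 1, …, n`. -/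
abbrev AgentParam (M n : ℕ) : Type :=
  (Fin n → Fin M) × (Fin n → ℝ) × (Fin n → ℝ) × (Fin n → ℝ) × (Fin n → ℝ)

namespace AgentParam

variable {M n : ℕ} (y : AgentParam M n)

/-- Target `i_ℓ` of phase `ℓ`. -/
def target (ℓ : Fin n) : Fin M := y.1 ℓ

/-- End time `t̄_ℓ` of phase `ℓ`. -/
def tEnd (ℓ : Fin n) : ℝ := y.2.1 ℓ

/-- First switching time `ť_ℓ` of phase `ℓ`. -/
def tCheck (ℓ : Fin n) : ℝ := y.2.2.1 ℓ

/-- Second switching time `t̂_ℓ` of phase `ℓ`. -/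
def tHat (ℓ : Fin n) : ℝ := y.2.2.2.1 ℓ

/-- Switching position `s_ℓ` at the end of phase `ℓ`. -/
def sEnd (ℓ : Fin n) : ℝ := y.2.2.2.2 ℓ

/-- Start time `t̄_{ℓ-1}` of phase `ℓ`, where `t̄_0 = 0`. -/
def tStart (ℓ : Fin n) : ℝ := (Fin.cons 0 y.tEnd : Fin (n + 1) → ℝ) ℓ.castSucc

/-- Position `s_{ℓ-1}` at the start of phase `ℓ`, where `s_0 = s₀` is given. -/
def sStart (s₀ : ℝ) (ℓ : Fin n) : ℝ := (Fin.cons s₀ y.sEnd : Fin (n + 1) → ℝ) ℓ.castSucc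

end AgentParam

/-- The parameter space of agent `j`:
`t̄_{ℓ-1} ≤ ť_ℓ ≤ t̂_ℓ ≤ t̄_ℓ` and `|s_ℓ - s_0| ≤ t̄_ℓ` for all `ℓ`, with `t̄_n = T`. -/
def agentParamSpace (n : ℕ) (j : Fin N) : Set (AgentParam M n) :=
  {y | (Fin.cons 0 y.tEnd : Fin (n + 1) → ℝ) (Fin.last n) = P.T ∧
    ∀ ℓ, y.tStart ℓ ≤ y.tCheck ℓ ∧ y.tCheck ℓ ≤ y.tHat ℓ ∧ y.tHat ℓ ≤ y.tEnd ℓ ∧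
      |y.sEnd ℓ - P.s₀ j| ≤ y.tEnd ℓ}

/-- The full parameter space: the product of the parameter spaces of the agents. -/
def paramSpace (n : ℕ) : Set (Fin N → AgentParam M n) :=
  {π | ∀ j, π j ∈ P.agentParamSpace n j}

/-- The control described by a parameter.  For a parameter in the parameter space the intervals
below are pairwise disjoint and cover `[0, T)`, so that the sum is a definition by cases. -/
def paramControl (n : ℕ) (π : Fin N → AgentParam M n) (j : Fin N) (t : ℝ) : ℝ :=
  ∑ ℓ : Fin n,
    ((Set.Ico ((π j).tStart ℓ) ((π j).tCheck ℓ)).indicator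
        (fun _ => Real.sign
          (P.pos ((π j).target ℓ) ((π j).tStart ℓ) - (π j).sStart (P.s₀ j) ℓ)) t
      + (Set.Ico ((π j).tCheck ℓ) ((π j).tHat ℓ)).indicator (P.vel ((π j).target ℓ)) t
      + (Set.Ico ((π j).tHat ℓ) ((π j).tEnd ℓ)).indicator
        (fun _ => Real.sign
          ((π j).sEnd ℓ - P.pos ((π j).target ℓ) ((π j).tEnd ℓ))) t)

end MonitoringProblem

end

/-!
An optimal control exists by compactness, and any control can be replaced by a parameterized one of
no larger cost.

*Uncertainty.*  The dynamics of an uncertainty are `Ṙ = g` reflected at zero, where `g` depends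
continuously on time through the positions of the agents and targets.  A solution is given by the
one-dimensional Skorokhod map, `R(t) = X(t) - min (0, min_{[0,t]} X)` with `X(t) = R(0) + ∫₀ᵗ g`
(`isReflectedSolution_reflected`).  The comparison principle `IsReflectedSolution.le_of_le` yields
its uniqueness and its monotonicity in `g`: being closer to the observed targets lowers the cost
(`cost_le_cost`).

*Existence.*  The trajectories of speed at most one with given initial positions form a compact set
for pointwise convergence, on which evaluation is jointly continuous.  The Skorokhod map is explicit
enough to make the cost continuous on this set, so that it has a minimum
(`exists_optimal_trajectory`).

*Parameterization.*  Observing two different targets takes time more than `Δ / 2`, so that in each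
of the `n = ⌈2T/Δ⌉` phases of equal length `T / n ≤ Δ / 2` an agent observes at most one target.
Within a phase, keep the positions at both ends, pursue that target at full speed from the initial
position and, backwards in time, from the final position, and move with the target in between; if
the two pursuits meet before reaching the target, concatenate them there.  At no time is the agent
farther from the target than before (`exists_switching_times`), and the resulting trajectory is the
one of a parameter (`exists_agentParam`).  Applied to a minimizing trajectory, this gives the
optimal parameter.
-/

namespace PersistentMonitoring

open Set Filter Topology

/-! ### Scalar dynamics reflected at zero -/

/-- `R` is a nonnegative Carathéodory solution on `[0, T]` with initial value `r₀` of the dynamics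
`Ṙ = g` reflected at zero: the rate `g` is replaced by `0` when `R = 0` and `g < 0`. -/
structure IsReflectedSolution (T r₀ : ℝ) (g R : ℝ → ℝ) : Prop where
  nonneg : ∀ t ∈ Icc 0 T, 0 ≤ R t
  integrable : IntervalIntegrable (fun τ => if R τ = 0 ∧ g τ < 0 then 0 else g τ) volume 0 T
  eq_integral : ∀ t ∈ Icc 0 T, R t = r₀ + ∫ τ in (0 : ℝ)..t, if R τ = 0 ∧ g τ < 0 then 0 else g τ

namespace IsReflectedSolution

variable {T r₀ : ℝ} {g g' R R' : ℝ → ℝ}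

lemma congr (hT : 0 ≤ T) (h : IsReflectedSolution T r₀ g R) (hg : EqOn g g' (Icc 0 T)) :
    IsReflectedSolution T r₀ g' R := by
  have key : ∀ t ∈ Icc 0 T, EqOn (fun τ => if R τ = 0 ∧ g τ < 0 then 0 else g τ)
      (fun τ => if R τ = 0 ∧ g' τ < 0 then 0 else g' τ) (uIcc 0 t) := by
    intro t ht τ hτ
    rw [uIcc_of_le ht.1] at hτ
    simp only [hg ⟨hτ.1, hτ.2.trans ht.2⟩]
  refine ⟨h.nonneg, ?_, fun t ht => ?_⟩
  · exact h.integrable.congr fun x hx => key T ⟨hT, le_rfl⟩ (uIoc_subset_uIcc hx)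
  · rw [h.eq_integral t ht, intervalIntegral.integral_congr (key t ht)]

lemma continuousOn (hT : 0 ≤ T) (h : IsReflectedSolution T r₀ g R) : ContinuousOn R (Icc 0 T) := by
  have := intervalIntegral.continuousOn_primitive_interval' h.integrable left_mem_uIcc
  rw [uIcc_of_le hT] at this
  exact (this.const_add r₀).congr fun t ht => h.eq_integral t ht

/-- Comparison principle: a smaller rate produces a smaller reflected solution.  After the last time
at which `R' ≤ R`, the solution `R'` is positive and hence grows at its unreflected rate, which is
at most the rate of `R`. -/
theorem le_of_le (hT : 0 ≤ T) (h : IsReflectedSolution T r₀ g R)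
    (h' : IsReflectedSolution T r₀ g' R') (hg : ∀ t ∈ Icc 0 T, g' t ≤ g t) :
    ∀ t ∈ Icc 0 T, R' t ≤ R t := by
  intro t ht
  by_contra! hlt
  set S : Set ℝ := {x ∈ Icc 0 t | R' x ≤ R x} with hS
  have hsub : Icc 0 t ⊆ Icc 0 T := Icc_subset_Icc_right ht.2
  have hSc : IsCompact S := by
    refine isCompact_Icc.of_isClosed_subset ?_ (sep_subset _ _)
    exact isClosed_Icc.isClosed_le ((h'.continuousOn hT).mono hsub) ((h.continuousOn hT).mono hsub)
  have h0 : (0 : ℝ) ∈ S := by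
    refine ⟨⟨le_rfl, ht.1⟩, ?_⟩
    rw [h.eq_integral 0 ⟨le_rfl, hT⟩, h'.eq_integral 0 ⟨le_rfl, hT⟩]
    simp
  obtain ⟨a, ⟨ha, haR⟩, hmax⟩ := hSc.exists_isGreatest ⟨0, h0⟩
  have hat : a ≤ t := ha.2
  have haT : a ∈ Icc 0 T := hsub ha
  have hI : ∀ {g R : ℝ → ℝ}, IsReflectedSolution T r₀ g R →
      IntervalIntegrable (fun τ => if R τ = 0 ∧ g τ < 0 then 0 else g τ) volume a t ∧
      R t - R a = ∫ τ in a..t, if R τ = 0 ∧ g τ < 0 then 0 else g τ := by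
    intro g R h
    have h1 : ∀ {x y}, x ∈ Icc 0 T → y ∈ Icc 0 T →
        IntervalIntegrable (fun τ => if R τ = 0 ∧ g τ < 0 then 0 else g τ) volume x y := by
      intro x y hx hy
      refine h.integrable.mono_set ?_
      rw [uIcc_of_le hT]
      exact uIcc_subset_Icc hx hy
    refine ⟨h1 haT ht, ?_⟩
    rw [h.eq_integral t ht, h.eq_integral a haT, add_sub_add_left_eq_sub,
      intervalIntegral.integral_interval_sub_left (h1 ⟨le_rfl, hT⟩ ht) (h1 ⟨le_rfl, hT⟩ haT)]
  obtain ⟨i1, e1⟩ := hI h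
  obtain ⟨i2, e2⟩ := hI h'
  have hle : ∫ τ in a..t, (if R' τ = 0 ∧ g' τ < 0 then 0 else g' τ)
      ≤ ∫ τ in a..t, (if R τ = 0 ∧ g τ < 0 then 0 else g τ) := by
    refine intervalIntegral.integral_mono_on_of_le_Ioo hat i2 i1 fun x hx => ?_
    have hxt : x ∈ Icc 0 t := ⟨ha.1.trans hx.1.le, hx.2.le⟩
    have hxR : R x < R' x := by
      by_contra! hc
      exact absurd (hmax ⟨hxt, hc⟩) (not_le.2 hx.1)
    have hpos : R' x ≠ 0 := ((h.nonneg x (hsub hxt)).trans_lt hxR).ne'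
    rw [if_neg (fun hc => hpos hc.1)]
    split_ifs with hc
    · exact (hg x (hsub hxt)).trans hc.2.le
    · exact hg x (hsub hxt)
  linarith

lemma eqOn (hT : 0 ≤ T) (h : IsReflectedSolution T r₀ g R) (h' : IsReflectedSolution T r₀ g R') :
    EqOn R' R (Icc 0 T) := fun t ht =>
  le_antisymm (h.le_of_le hT h' (fun _ _ => le_rfl) t ht)
    (h'.le_of_le hT h (fun _ _ => le_rfl) t ht)

end IsReflectedSolution

/-- The largest nonpositive lower bound of `X` on `[0, t]`.  The interval is parameterized by
`[0, 1]`, which makes continuity in `t` evident, and `t` is replaced by `max t 0`, which makes the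
function antitone on the whole line. -/
noncomputable def runningMin (X : ℝ → ℝ) (t : ℝ) : ℝ :=
  min 0 (sInf ((fun σ => X (σ * max t 0)) '' Icc 0 1))

section runningMin

variable {X : ℝ → ℝ}

lemma runningMin_nonpos (t : ℝ) : runningMin X t ≤ 0 := min_le_left _ _

lemma runningMin_le (hX : Continuous X) {s t : ℝ} (hs : 0 ≤ s) (hst : s ≤ t) :
    runningMin X t ≤ X s := by
  refine (min_le_right _ _).trans (csInf_le ?_ ?_)
  · exact (isCompact_Icc.image (by fun_prop)).bddBelow
  · rcases hs.eq_or_lt with rfl | hs'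
    · exact ⟨0, ⟨le_rfl, zero_le_one⟩, by simp⟩
    · have ht : 0 < t := hs'.trans_le hst
      refine ⟨s / t, ⟨by positivity, (div_le_one ht).2 hst⟩, ?_⟩
      simp only [max_eq_left ht.le]
      congr 1
      field_simp

lemma le_runningMin {c t : ℝ} (hc : c ≤ 0) (h : ∀ s, 0 ≤ s → s ≤ max t 0 → c ≤ X s) :
    c ≤ runningMin X t := by
  refine le_min hc (le_csInf (Nonempty.image _ ⟨0, le_rfl, zero_le_one⟩) ?_)
  rintro _ ⟨σ, hσ, rfl⟩
  exact h _ (mul_nonneg hσ.1 (le_max_right _ _))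
    (mul_le_of_le_one_left (le_max_right _ _) hσ.2)

lemma runningMin_max (t : ℝ) : runningMin X (max t 0) = runningMin X t := by
  simp [runningMin]

lemma antitone_runningMin (hX : Continuous X) : Antitone (runningMin X) := by
  intro s t hst
  refine le_runningMin (runningMin_nonpos _) fun x hx hxs => ?_
  rw [← runningMin_max]
  exact runningMin_le hX hx (hxs.trans (max_le_max_right _ hst))

/-- The running minimum over `[0, t]` is controlled by the one over `[0, s]` and by the values on
`[s, t]`. -/
lemma le_runningMin_of_le (hX : Continuous X) {c s t : ℝ} (hs : 0 ≤ s) (hst : s ≤ t)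
    (h1 : c ≤ runningMin X s) (h2 : ∀ x ∈ Icc s t, c ≤ X x) : c ≤ runningMin X t := by
  refine le_runningMin (h1.trans (runningMin_nonpos _)) fun x hx hxt => ?_
  rw [max_eq_left (hs.trans hst)] at hxt
  rcases le_total x s with hxs | hxs
  · exact h1.trans (runningMin_le hX hx hxs)
  · exact h2 x ⟨hxs, hxt⟩

/-- The running minimum is locally constant where it differs from the function. -/
lemma runningMin_eventuallyEq (hX : Continuous X) {t : ℝ} (ht : 0 < t)
    (h : runningMin X t < X t) : runningMin X =ᶠ[𝓝 t] fun _ => runningMin X t := by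
  obtain ⟨q, hq1, hq2⟩ := exists_between h
  have hev : ∀ᶠ x in 𝓝 t, q < X x ∧ 0 < x :=
    (hX.continuousAt.eventually_const_lt hq2).and (lt_mem_nhds ht)
  obtain ⟨ε, hε, hball⟩ := Metric.eventually_nhds_iff_ball.1 hev
  have hconv : OrdConnected (Metric.ball t ε) := (convex_ball t ε).ordConnected
  have htb : t ∈ Metric.ball t ε := Metric.mem_ball_self hε
  filter_upwards [Metric.ball_mem_nhds t hε] with x hx
  rcases le_total x t with hxt | hxt
  · refine le_antisymm ?_ (antitone_runningMin hX hxt)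
    by_contra! hc
    have := le_runningMin_of_le hX (c := min q (runningMin X x)) (hball x hx).2.le hxt
      (min_le_right _ _)
      fun y hy => (min_le_left _ _).trans (hball y (hconv.out hx htb hy)).1.le
    exact absurd this (not_le.2 (lt_min hq1 hc))
  · refine le_antisymm (antitone_runningMin hX hxt) ?_
    exact le_runningMin_of_le hX ht.le hxt le_rfl fun y hy =>
      hq1.le.trans (hball y (hconv.out htb hx hy)).1.le

lemma runningMin_lipschitz (hX : Continuous X) {C T : ℝ} (hC : 0 ≤ C)
    (hL : ∀ x ∈ Icc 0 T, ∀ y ∈ Icc 0 T, |X x - X y| ≤ C * |x - y|) :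
    ∀ x ∈ Icc 0 T, ∀ y ∈ Icc 0 T, |runningMin X x - runningMin X y| ≤ C * |x - y| := by
  have key : ∀ x ∈ Icc 0 T, ∀ y ∈ Icc 0 T, x ≤ y →
      |runningMin X x - runningMin X y| ≤ C * |x - y| := by
    intro x hx y hy hxy
    have h1 := antitone_runningMin hX hxy
    have h2 : runningMin X x - C * (y - x) ≤ runningMin X y := by
      refine le_runningMin_of_le hX hx.1 hxy ?_ fun z hz => ?_
      · nlinarith
      · have := hL x hx z ⟨hx.1.trans hz.1, hz.2.trans hy.2⟩
        have h3 := runningMin_le hX hx.1 (le_refl x)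
        rw [abs_sub_comm x z, abs_of_nonneg (sub_nonneg.2 hz.1)] at this
        have h4 := (abs_le.1 this).2
        nlinarith [mul_le_mul_of_nonneg_left hz.2 hC]
    rw [abs_of_nonneg (sub_nonneg.2 h1), abs_sub_comm, abs_of_nonneg (sub_nonneg.2 hxy)]
    linarith
  intro x hx y hy
  rcases le_total x y with h | h
  · exact key x hx y hy h
  · rw [abs_sub_comm, abs_sub_comm x y]
    exact key y hy x hx h

end runningMin

/-- The reflection at zero of `t ↦ r₀ + ∫₀ᵗ g` (the Skorokhod map in dimension one). -/
noncomputable def reflected (r₀ : ℝ) (g : ℝ → ℝ) (t : ℝ) : ℝ :=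
  (r₀ + ∫ τ in (0 : ℝ)..t, g τ) - runningMin (fun t => r₀ + ∫ τ in (0 : ℝ)..t, g τ) t

/-- The Skorokhod map is jointly continuous in time and in a parameter of the rate. -/
lemma continuous_reflected {E : Type*} [TopologicalSpace E] (r₀ : ℝ) {g : E → ℝ → ℝ}
    (hg : Continuous g.uncurry) : Continuous fun p : E × ℝ => reflected r₀ (g p.1) p.2 := by
  have hX : Continuous fun p : E × ℝ => r₀ + ∫ τ in (0 : ℝ)..p.2, g p.1 τ :=
    (intervalIntegral.continuous_parametric_primitive_of_continuous hg).const_add r₀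
  refine hX.sub (continuous_const.min ?_)
  refine isCompact_Icc.continuous_sInf
    (f := fun (p : E × ℝ) (σ : ℝ) => r₀ + ∫ τ in (0 : ℝ)..(σ * max p.2 0), g p.1 τ) ?_
  exact hX.comp (f := fun q : (E × ℝ) × ℝ => (q.1.1, q.2 * max q.1.2 0)) (by fun_prop)

/-- The Skorokhod map solves the reflected dynamics.  At almost every time `t` the reflected
function `R` is differentiable.  If `R t > 0`, the running minimum is locally constant and `R' = g`;
if `R t = 0`, then `t` is a minimum of `R`, so `R' = 0`, and `g t ≤ R' t` since the running minimum
is antitone. -/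
theorem isReflectedSolution_reflected {T r₀ : ℝ} (hT : 0 ≤ T) (hr : 0 ≤ r₀) {g : ℝ → ℝ}
    (hg : Continuous g) : IsReflectedSolution T r₀ g (reflected r₀ g) := by
  set X : ℝ → ℝ := fun t => r₀ + ∫ τ in (0 : ℝ)..t, g τ with hXdef
  set R := reflected r₀ g with hRdef
  have hXd : ∀ t, HasDerivAt X (g t) t := fun t =>
    (intervalIntegral.integral_hasDerivAt_right (hg.intervalIntegrable _ _)
      (hg.stronglyMeasurableAtFilter _ _) hg.continuousAt).const_add r₀
  have hX : Continuous X := continuous_iff_continuousAt.2 fun t => (hXd t).continuousAt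
  have hR : ∀ t, R t = X t - runningMin X t := fun t => rfl
  have hR0 : ∀ t, 0 ≤ t → 0 ≤ R t := fun t ht => by
    rw [hR]; exact sub_nonneg.2 (runningMin_le hX ht le_rfl)
  have hRc : Continuous R :=
    (continuous_reflected (E := Unit) r₀ (g := fun _ => g) (by
      exact hg.comp continuous_snd)).comp (f := fun t : ℝ => ((), t)) (by fun_prop)
  obtain ⟨C, hC⟩ := isCompact_Icc.exists_bound_of_continuousOn (s := Icc 0 T) hg.continuousOn
  have hC0 : 0 ≤ C := (norm_nonneg _).trans (hC 0 ⟨le_rfl, hT⟩)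
  have hXL : ∀ x ∈ Icc 0 T, ∀ y ∈ Icc 0 T, |X x - X y| ≤ C * |x - y| := by
    intro x hx y hy
    exact (convex_Icc 0 T).norm_image_sub_le_of_norm_hasDerivWithin_le
      (fun z _ => (hXd z).hasDerivWithinAt) hC hy hx
  have hML := runningMin_lipschitz hX hC0 hXL
  have hLip : ∀ t ∈ Icc 0 T, LipschitzOnWith (Real.toNNReal (2 * C)) R (uIcc 0 t) := by
    intro t ht
    refine LipschitzOnWith.of_dist_le_mul fun x hx y hy => ?_
    rw [uIcc_of_le ht.1] at hx hy
    replace hx : x ∈ Icc 0 T := ⟨hx.1, hx.2.trans ht.2⟩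
    replace hy : y ∈ Icc 0 T := ⟨hy.1, hy.2.trans ht.2⟩
    rw [Real.coe_toNNReal _ (by positivity), Real.dist_eq, Real.dist_eq, hR, hR]
    calc _ = |(X x - X y) - (runningMin X x - runningMin X y)| := by ring_nf
      _ ≤ _ := abs_sub _ _
      _ ≤ _ := by linarith [hXL x hx y hy, hML x hx y hy]
  have hder : ∀ t, 0 < t → DifferentiableAt ℝ R t →
      deriv R t = if R t = 0 ∧ g t < 0 then 0 else g t := by
    intro t ht hd
    have hMd : DifferentiableAt ℝ (runningMin X) t := by
      have : runningMin X = fun t => X t - R t := by ext t; rw [hR]; ring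
      rw [this]
      exact (hXd t).differentiableAt.sub hd
    have hsum : deriv R t = g t - deriv (runningMin X) t :=
      ((hXd t).sub hMd.hasDerivAt).deriv
    rcases (hR0 t ht.le).eq_or_lt with h0 | hpos
    · have hmin : IsLocalMin R t := by
        filter_upwards [lt_mem_nhds ht] with x hx
        rw [← h0]
        exact hR0 x hx.le
      have h1 := hmin.deriv_eq_zero
      have h2 : deriv (runningMin X) t ≤ 0 := (antitone_runningMin hX).deriv_nonpos
      split_ifs with hc
      · exact h1
      · have : 0 ≤ g t := by
          by_contra! hneg
          exact hc ⟨h0.symm, hneg⟩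
        linarith
    · rw [if_neg (fun hc => hpos.ne' hc.1), hsum,
        (runningMin_eventuallyEq hX ht (by rw [hR] at hpos; linarith)).deriv_eq]
      simp
  have hinit : R 0 = r₀ := by
    rw [hR]
    have h1 : X 0 = r₀ := by simp [hXdef]
    have h2 : runningMin X 0 = 0 := by
      refine le_antisymm (runningMin_nonpos _) (le_runningMin le_rfl fun s hs hs' => ?_)
      have : s = 0 := le_antisymm (by simpa using hs') hs
      rw [this, h1]; exact hr
    rw [h1, h2, sub_zero]
  have hae : ∀ t ∈ Icc 0 T, ∀ᵐ x ∂volume, x ∈ uIoc 0 t →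
      deriv R x = if R x = 0 ∧ g x < 0 then 0 else g x := by
    intro t ht
    have hac := (hLip t ht).absolutelyContinuousOnInterval
    filter_upwards [hac.ae_differentiableAt] with x hx hxt
    rw [uIoc_of_le ht.1] at hxt
    exact hder x hxt.1 (hx (by rw [uIcc_of_le ht.1]; exact Ioc_subset_Icc_self hxt))
  refine ⟨fun t ht => hR0 t ht.1, ?_, fun t ht => ?_⟩
  · exact (hLip T ⟨hT, le_rfl⟩).absolutelyContinuousOnInterval.intervalIntegrable_deriv.congr_ae
      ((ae_restrict_iff' measurableSet_uIoc).2 (hae T ⟨hT, le_rfl⟩))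
  · rw [← intervalIntegral.integral_congr_ae (hae t ht),
      (hLip t ht).absolutelyContinuousOnInterval.integral_deriv_eq_sub, hinit]
    ring

/-! ### Replacing a trajectory on one phase -/

section Phase

variable {a b : ℝ} {s ϑ : ℝ → ℝ}

/-- The signed distance at time `t` by which the target `ϑ` is ahead of a pursuit at full speed that
is at position `s e` at time `e`, forwards (`e ≤ t`) or backwards (`t ≤ e`) in time.  As long as it
is nonnegative, the target has not been passed.  If the pursuit starts at the target, it does not
move, and the margin is `-|t - e|`, which is nonnegative at time `e` only. -/
noncomputable def pursuitMargin (s ϑ : ℝ → ℝ) (e t : ℝ) : ℝ :=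
  Real.sign (ϑ e - s e) * (ϑ t - s e) - |t - e|

lemma pursuitMargin_self_nonneg (e : ℝ) : 0 ≤ pursuitMargin s ϑ e e := by
  unfold pursuitMargin
  rcases lt_trichotomy (ϑ e - s e) 0 with h | h | h
  · rw [Real.sign_of_neg h]; simp; linarith
  · simp [h]
  · rw [Real.sign_of_pos h]; simp; linarith

lemma continuousOn_pursuitMargin {S : Set ℝ} (hϑ : ContinuousOn ϑ S) (e : ℝ) :
    ContinuousOn (pursuitMargin s ϑ e) S := by
  unfold pursuitMargin
  fun_prop

lemma pursuitMargin_le (hϑ : ∀ x ∈ Icc a b, ∀ y ∈ Icc a b, |ϑ x - ϑ y| ≤ |x - y|) {e x y : ℝ}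
    (hx : x ∈ Icc a b) (hy : y ∈ Icc a b) (hxy : |y - e| = |x - e| + |y - x|) :
    pursuitMargin s ϑ e y ≤ pursuitMargin s ϑ e x := by
  unfold pursuitMargin
  have h := abs_le.1 (hϑ y hy x hx)
  rcases Real.sign_apply_eq (ϑ e - s e) with h' | h' | h' <;> rw [h', hxy] <;>
    linarith [abs_nonneg (y - x)]

/-- The position of the pursuit is hit exactly when the margin vanishes. -/
lemma pursuit_eq_target {e t : ℝ} (h : pursuitMargin s ϑ e t = 0) :
    s e + Real.sign (ϑ e - s e) * |t - e| = ϑ t := by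
  unfold pursuitMargin at h
  rcases Real.sign_apply_eq (ϑ e - s e) with h' | h' | h' <;> rw [h'] at h ⊢
  · linarith
  · have h1 : t = e := by
      have : |t - e| = 0 := by linarith
      linarith [abs_eq_zero.1 this]
    subst h1
    linarith [Real.sign_eq_zero_iff.1 h']
  · linarith

/-- Until the target is passed, pursuing it at full speed is at least as good as any other
trajectory with speed at most one. -/
lemma abs_pursuit_sub_le (hs : ∀ x ∈ Icc a b, ∀ y ∈ Icc a b, |s x - s y| ≤ |x - y|) {e t : ℝ}
    (he : e ∈ Icc a b) (ht : t ∈ Icc a b) (h : 0 ≤ pursuitMargin s ϑ e t) :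
    |s e + Real.sign (ϑ e - s e) * |t - e| - ϑ t| ≤ |s t - ϑ t| := by
  unfold pursuitMargin at h
  have hL := abs_le.1 (hs t ht e he)
  rcases Real.sign_apply_eq (ϑ e - s e) with h' | h' | h' <;> rw [h'] at h ⊢
  · exact abs_le_abs_of_nonneg (by linarith) (by linarith)
  · have h1 : t = e := by
      have : |t - e| = 0 := le_antisymm (by linarith) (abs_nonneg _)
      linarith [abs_eq_zero.1 this]
    simp [h1]
  · exact abs_le_abs_of_nonpos (by linarith) (by linarith)

/-- If the margins of the pursuits from both ends are nonnegative at a common time, then at some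
such time the two pursuits meet. -/
lemma exists_pursuits_meet
    (hs : ∀ x ∈ Icc a b, ∀ y ∈ Icc a b, |s x - s y| ≤ |x - y|)
    (hϑ : ∀ x ∈ Icc a b, ∀ y ∈ Icc a b, |ϑ x - ϑ y| ≤ |x - y|) {x : ℝ} (hx : x ∈ Icc a b)
    (hxa : 0 ≤ pursuitMargin s ϑ a x) (hxb : 0 ≤ pursuitMargin s ϑ b x) :
    ∃ t ∈ Icc a b, 0 ≤ pursuitMargin s ϑ a t ∧ 0 ≤ pursuitMargin s ϑ b t ∧
      s a + Real.sign (ϑ a - s a) * (t - a) = s b + Real.sign (ϑ b - s b) * (b - t) := by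
  have ha : a ∈ Icc a b := ⟨le_rfl, hx.1.trans hx.2⟩
  have hb : b ∈ Icc a b := ⟨hx.1.trans hx.2, le_rfl⟩
  have ea : ∀ t ∈ Icc a b, |t - a| = t - a := fun t ht => abs_of_nonneg (sub_nonneg.2 ht.1)
  have eb : ∀ t ∈ Icc a b, |t - b| = b - t := fun t ht => by
    rw [abs_of_nonpos (sub_nonpos.2 ht.2)]; ring
  -- Equal directions: the two rays meet at time `t`, where the two margins agree.
  have same : ∀ σ : ℝ, σ = 1 ∨ σ = -1 → Real.sign (ϑ a - s a) = σ → Real.sign (ϑ b - s b) = σ →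
      ∃ t ∈ Icc a b, 0 ≤ pursuitMargin s ϑ a t ∧ 0 ≤ pursuitMargin s ϑ b t ∧
        s a + Real.sign (ϑ a - s a) * (t - a) = s b + Real.sign (ϑ b - s b) * (b - t) := by
    intro σ hσ hσa hσb
    have hL := abs_le.1 (hs b hb a ha)
    rw [ea b hb] at hL
    set t : ℝ := (a + b + σ * (s b - s a)) / 2 with ht
    have htI : t ∈ Icc a b := by
      rcases hσ with rfl | rfl <;> constructor <;> linarith
    have hmeet : s a + σ * (t - a) = s b + σ * (b - t) := by
      rcases hσ with rfl | rfl <;> linarith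
    have heq : pursuitMargin s ϑ a t = pursuitMargin s ϑ b t := by
      unfold pursuitMargin
      rw [hσa, hσb, ea t htI, eb t htI]
      rcases hσ with rfl | rfl <;> linarith
    refine ⟨t, htI, ?_⟩
    rw [hσa, hσb, ← heq, and_self_left]
    refine ⟨?_, hmeet⟩
    rcases le_total t x with h | h
    · refine hxa.trans (pursuitMargin_le hϑ htI hx ?_)
      rw [ea x hx, ea t htI, abs_of_nonneg (sub_nonneg.2 h)]; ring
    · rw [heq]
      refine hxb.trans (pursuitMargin_le hϑ htI hx ?_)
      rw [eb x hx, eb t htI, abs_of_nonpos (sub_nonpos.2 h)]; ring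
  by_cases hcase : Real.sign (ϑ a - s a) = Real.sign (ϑ b - s b) ∧ Real.sign (ϑ a - s a) ≠ 0
  · refine same _ ?_ rfl hcase.1.symm
    rcases Real.sign_apply_eq (ϑ a - s a) with h | h | h
    · exact Or.inr h
    · exact absurd h hcase.2
    · exact Or.inl h
  -- Otherwise both pursuits are at the position of the trajectory at time `x`.
  refine ⟨x, hx, hxa, hxb, ?_⟩
  have hLa := abs_le.1 (hs x hx a ha)
  have hLb := abs_le.1 (hs x hx b hb)
  unfold pursuitMargin at hxa hxb
  rw [ea x hx] at hxa hLa
  rw [eb x hx] at hxb hLb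
  obtain ⟨hx1, hx2⟩ := hx
  rcases Real.sign_apply_eq (ϑ a - s a) with h | h | h <;>
    rcases Real.sign_apply_eq (ϑ b - s b) with h' | h' | h' <;>
    simp only [h, h'] at hxa hxb hcase ⊢ <;> norm_num at hcase
  · have hxb' : x = b := by linarith
    subst hxb'
    linarith [Real.sign_eq_zero_iff.1 h']
  · linarith
  · have hxa' : x = a := by linarith
    subst hxa'
    linarith [Real.sign_eq_zero_iff.1 h]
  · have hxa' : x = a := by linarith
    have hxb' : x = b := by linarith
    rw [← hxa', ← hxb']
  · have hxa' : x = a := by linarith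
    subst hxa'
    linarith [Real.sign_eq_zero_iff.1 h]
  · linarith
  · have hxb' : x = b := by linarith
    subst hxb'
    linarith [Real.sign_eq_zero_iff.1 h']

/-- A trajectory `s` of speed at most one can be replaced on `[a, b]`, without changing its
endpoints, by one that runs at full speed towards the target `ϑ` until time `c`, then moves with the
target until time `d`, and finally leaves at full speed, so that the distance to the target does not
increase at any time. -/
theorem exists_switching_times (hab : a ≤ b)
    (hs : ∀ x ∈ Icc a b, ∀ y ∈ Icc a b, |s x - s y| ≤ |x - y|)
    (hϑ : ∀ x ∈ Icc a b, ∀ y ∈ Icc a b, |ϑ x - ϑ y| ≤ |x - y|) :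
    ∃ c d, a ≤ c ∧ c ≤ d ∧ d ≤ b ∧
      (∀ t ∈ Icc a c, |s a + Real.sign (ϑ a - s a) * (t - a) - ϑ t| ≤ |s t - ϑ t|) ∧
      (∀ t ∈ Icc c d,
        |s a + Real.sign (ϑ a - s a) * (c - a) + (ϑ t - ϑ c) - ϑ t| ≤ |s t - ϑ t|) ∧
      (∀ t ∈ Icc d b, |s b - Real.sign (s b - ϑ b) * (b - t) - ϑ t| ≤ |s t - ϑ t|) ∧
      s a + Real.sign (ϑ a - s a) * (c - a) + (ϑ d - ϑ c)
        = s b - Real.sign (s b - ϑ b) * (b - d) := by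
  have ha : a ∈ Icc a b := ⟨le_rfl, hab⟩
  have hb : b ∈ Icc a b := ⟨hab, le_rfl⟩
  have ea : ∀ t ∈ Icc a b, |t - a| = t - a := fun t ht => abs_of_nonneg (sub_nonneg.2 ht.1)
  have eb : ∀ t ∈ Icc a b, |t - b| = b - t := fun t ht => by
    rw [abs_of_nonpos (sub_nonpos.2 ht.2)]; ring
  have hsign : Real.sign (s b - ϑ b) = -Real.sign (ϑ b - s b) := by
    rw [← Real.sign_neg, neg_sub]
  have hneg : ∀ t, s b - -Real.sign (ϑ b - s b) * (b - t) =
    s b + Real.sign (ϑ b - s b) * (b - t) := fun t => by ring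
  simp only [hsign, hneg]
  have mono_a : ∀ {x y}, x ∈ Icc a b → y ∈ Icc a b → x ≤ y →
      pursuitMargin s ϑ a y ≤ pursuitMargin s ϑ a x := by
    intro x y hx hy hxy
    refine pursuitMargin_le hϑ hx hy ?_
    rw [ea x hx, ea y hy, abs_of_nonneg (sub_nonneg.2 hxy)]; ring
  have mono_b : ∀ {x y}, x ∈ Icc a b → y ∈ Icc a b → x ≤ y →
      pursuitMargin s ϑ b x ≤ pursuitMargin s ϑ b y := by
    intro x y hx hy hxy
    refine pursuitMargin_le hϑ hy hx ?_
    rw [eb x hx, eb y hy, abs_of_nonpos (sub_nonpos.2 hxy)]; ring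
  -- The estimates on `[a, c]` and `[d, b]` hold if the margins at `c` and `d` are nonnegative.
  have first : ∀ c ∈ Icc a b, 0 ≤ pursuitMargin s ϑ a c → ∀ t ∈ Icc a c,
      |s a + Real.sign (ϑ a - s a) * (t - a) - ϑ t| ≤ |s t - ϑ t| := by
    intro c hc h t ht
    have htI : t ∈ Icc a b := ⟨ht.1, ht.2.trans hc.2⟩
    have := abs_pursuit_sub_le hs ha htI (h.trans (mono_a htI hc ht.2))
    rwa [ea t htI] at this
  have last : ∀ d ∈ Icc a b, 0 ≤ pursuitMargin s ϑ b d → ∀ t ∈ Icc d b,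
      |s b + Real.sign (ϑ b - s b) * (b - t) - ϑ t| ≤ |s t - ϑ t| := by
    intro d hd h t ht
    have htI : t ∈ Icc a b := ⟨hd.1.trans ht.1, ht.2⟩
    have := abs_pursuit_sub_le hs hb htI (h.trans (mono_b hd htI ht.1))
    rwa [eb t htI] at this
  by_cases hex : ∃ x ∈ Icc a b, 0 ≤ pursuitMargin s ϑ a x ∧ 0 ≤ pursuitMargin s ϑ b x
  · -- The target is not reached in between: the pursuits from both ends are concatenated.
    obtain ⟨x, hx, hxa, hxb⟩ := hex
    obtain ⟨t, ht, hta, htb, hmeet⟩ := exists_pursuits_meet hs hϑ hx hxa hxb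
    refine ⟨t, t, ht.1, le_rfl, ht.2, first t ht hta, fun τ hτ => ?_, last t ht htb, ?_⟩
    · have : τ = t := le_antisymm hτ.2 hτ.1
      rw [this, sub_self, add_zero]
      exact first t ht hta t ⟨ht.1, le_rfl⟩
    · rw [sub_self, add_zero, hmeet]
  · -- The target is reached from both ends, where the respective margins vanish.
    push Not at hex
    have hϑc : ContinuousOn ϑ (Icc a b) := by
      refine (LipschitzOnWith.of_dist_le_mul (K := 1) fun x hx y hy => ?_).continuousOn
      simpa [Real.dist_eq] using hϑ x hx y hy
    have hb_neg : pursuitMargin s ϑ a b < 0 := by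
      by_contra! h
      exact absurd (hex b hb h) (not_lt.2 (pursuitMargin_self_nonneg b))
    have ha_neg : pursuitMargin s ϑ b a < 0 := hex a ha (pursuitMargin_self_nonneg a)
    obtain ⟨c, hc, hc0⟩ := intermediate_value_Icc' hab
      (continuousOn_pursuitMargin (s := s) hϑc a) ⟨hb_neg.le, pursuitMargin_self_nonneg a⟩
    obtain ⟨d, hd, hd0⟩ := intermediate_value_Icc hab
      (continuousOn_pursuitMargin (s := s) hϑc b) ⟨ha_neg.le, pursuitMargin_self_nonneg b⟩
    have hcd : c ≤ d := by
      by_contra! h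
      exact absurd (hex c hc hc0.ge) (not_lt.2 (hd0.ge.trans (mono_b hd hc h.le)))
    have hc1 := pursuit_eq_target hc0
    have hd1 := pursuit_eq_target hd0
    rw [ea c hc] at hc1
    rw [eb d hd] at hd1
    refine ⟨c, d, hc.1, hcd, hd.2, first c hc hc0.ge, fun t _ => ?_, last d hd hd0.ge, ?_⟩
    · rw [hc1, add_sub_cancel, sub_self, abs_zero]
      exact abs_nonneg _
    · rw [hc1, hd1, add_sub_cancel]

end Phase

end PersistentMonitoring

namespace MonitoringProblem

open Set Filter Topology PersistentMonitoring

/-! ### The parameter space -/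

namespace AgentParam

variable {n M : ℕ}

/-- The times `0, t̄_1, …, t̄_n` that delimit the phases. -/
def knots (y : AgentParam M n) : Fin (n + 1) → ℝ := Fin.cons 0 y.tEnd

lemma knots_castSucc (y : AgentParam M n) (ℓ : Fin n) : y.knots ℓ.castSucc = y.tStart ℓ := rfl

lemma knots_succ (y : AgentParam M n) (ℓ : Fin n) : y.knots ℓ.succ = y.tEnd ℓ := by
  simp [knots]

lemma knots_zero (y : AgentParam M n) : y.knots 0 = 0 := by simp [knots]

end AgentParam

section ParamSpace

variable {N M n : ℕ} {P : MonitoringProblem N M} {j : Fin N} {y : AgentParam M n}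

lemma monotone_knots (hy : y ∈ P.agentParamSpace n j) : Monotone y.knots := by
  refine Fin.monotone_iff_le_succ.2 fun ℓ => ?_
  rw [y.knots_castSucc, y.knots_succ]
  obtain ⟨h1, h2, h3, -⟩ := hy.2 ℓ
  exact h1.trans (h2.trans h3)

lemma knots_mem_Icc (hy : y ∈ P.agentParamSpace n j) (k : Fin (n + 1)) :
    y.knots k ∈ Icc 0 P.T := by
  constructor
  · rw [← y.knots_zero]; exact monotone_knots hy (Fin.zero_le k)
  · rw [← hy.1]; exact monotone_knots hy (Fin.le_last k)

lemma tStart_mem_Icc (hy : y ∈ P.agentParamSpace n j) (ℓ : Fin n) : y.tStart ℓ ∈ Icc 0 P.T :=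
  knots_mem_Icc hy _

lemma tEnd_mem_Icc (hy : y ∈ P.agentParamSpace n j) (ℓ : Fin n) : y.tEnd ℓ ∈ Icc 0 P.T := by
  rw [← y.knots_succ]; exact knots_mem_Icc hy _

lemma continuous_finCons_apply {α : Type*} [TopologicalSpace α] (c : α) (k : Fin (n + 1)) :
    Continuous fun v : Fin n → α => (Fin.cons c v : Fin (n + 1) → α) k := by
  refine Fin.cases ?_ (fun i => ?_) k
  · simpa using continuous_const
  · simpa using continuous_apply i

theorem isCompact_agentParamSpace (P : MonitoringProblem N M) (n : ℕ) (j : Fin N) :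
    IsCompact (P.agentParamSpace n j) := by
  have hK : IsCompact ((univ : Set (Fin n → Fin M)) ×ˢ Icc (0 : Fin n → ℝ) (fun _ => P.T) ×ˢ
      Icc (0 : Fin n → ℝ) (fun _ => P.T) ×ˢ Icc (0 : Fin n → ℝ) (fun _ => P.T) ×ˢ
      Icc (fun _ : Fin n => P.s₀ j - P.T) (fun _ => P.s₀ j + P.T)) :=
    isCompact_univ.prod (isCompact_Icc.prod (isCompact_Icc.prod (isCompact_Icc.prod isCompact_Icc)))
  refine hK.of_isClosed_subset ?_ ?_
  · have hknot : ∀ k, Continuous fun y : AgentParam M n =>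
        (Fin.cons 0 y.tEnd : Fin (n + 1) → ℝ) k := fun k =>
      (continuous_finCons_apply (0 : ℝ) k).comp (f := fun y : AgentParam M n => y.tEnd)
        (by unfold AgentParam.tEnd; fun_prop)
    have hC : ∀ ℓ, Continuous fun y : AgentParam M n => y.tCheck ℓ := fun ℓ => by
      unfold AgentParam.tCheck; fun_prop
    have hH : ∀ ℓ, Continuous fun y : AgentParam M n => y.tHat ℓ := fun ℓ => by
      unfold AgentParam.tHat; fun_prop
    have hE : ∀ ℓ, Continuous fun y : AgentParam M n => y.tEnd ℓ := fun ℓ => by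
      unfold AgentParam.tEnd; fun_prop
    have hS : ∀ ℓ, Continuous fun y : AgentParam M n => |y.sEnd ℓ - P.s₀ j| := fun ℓ => by
      unfold AgentParam.sEnd; fun_prop
    have hset : P.agentParamSpace n j =
        {y | (Fin.cons 0 (AgentParam.tEnd y) : Fin (n + 1) → ℝ) (Fin.last n) = P.T} ∩
          ⋂ ℓ, ({y | AgentParam.tStart y ℓ ≤ AgentParam.tCheck y ℓ} ∩
            ({y | AgentParam.tCheck y ℓ ≤ AgentParam.tHat y ℓ} ∩
              ({y | AgentParam.tHat y ℓ ≤ AgentParam.tEnd y ℓ} ∩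
                {y | |AgentParam.sEnd y ℓ - P.s₀ j| ≤ AgentParam.tEnd y ℓ}))) := by
      ext y; simp [agentParamSpace]
    rw [hset]
    refine (isClosed_eq (hknot _) continuous_const).inter ?_
    exact isClosed_iInter fun ℓ => (isClosed_le (hknot _) (hC ℓ)).inter
      ((isClosed_le (hC ℓ) (hH ℓ)).inter
        ((isClosed_le (hH ℓ) (hE ℓ)).inter (isClosed_le (hS ℓ) (hE ℓ))))
  · intro (y : AgentParam M n) hy
    have h : ∀ ℓ, (0 ≤ y.tEnd ℓ ∧ y.tEnd ℓ ≤ P.T) ∧ (0 ≤ y.tCheck ℓ ∧ y.tCheck ℓ ≤ P.T) ∧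
        (0 ≤ y.tHat ℓ ∧ y.tHat ℓ ≤ P.T) ∧
        (P.s₀ j - P.T ≤ y.sEnd ℓ ∧ y.sEnd ℓ ≤ P.s₀ j + P.T) := by
      intro ℓ
      obtain ⟨h1, h2, h3, h4⟩ := hy.2 ℓ
      obtain ⟨h5, -⟩ := tStart_mem_Icc hy ℓ
      obtain ⟨-, h6⟩ := tEnd_mem_Icc hy ℓ
      have h7 := abs_le.1 h4
      refine ⟨⟨?_, ?_⟩, ⟨?_, ?_⟩, ⟨?_, ?_⟩, ?_, ?_⟩ <;> linarith
    exact ⟨mem_univ _, ⟨fun ℓ => (h ℓ).1.1, fun ℓ => (h ℓ).1.2⟩,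
      ⟨fun ℓ => (h ℓ).2.1.1, fun ℓ => (h ℓ).2.1.2⟩,
      ⟨fun ℓ => (h ℓ).2.2.1.1, fun ℓ => (h ℓ).2.2.1.2⟩,
      ⟨fun ℓ => (h ℓ).2.2.2.1, fun ℓ => (h ℓ).2.2.2.2⟩⟩

theorem isCompact_paramSpace (P : MonitoringProblem N M) (n : ℕ) : IsCompact (P.paramSpace n) := by
  have : P.paramSpace n = univ.pi fun j => P.agentParamSpace n j := by
    ext π; simp [paramSpace]
  rw [this]
  exact isCompact_univ_pi fun j => P.isCompact_agentParamSpace n j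

/-! ### The control described by a parameter -/

/-- The part of the control of an agent with initial position `s₀` that belongs to phase `ℓ`. -/
noncomputable def phaseControl (P : MonitoringProblem N M) (s₀ : ℝ) (y : AgentParam M n) (ℓ : Fin n)
    (t : ℝ) : ℝ :=
  (Ico (y.tStart ℓ) (y.tCheck ℓ)).indicator
      (fun _ => Real.sign (P.pos (y.target ℓ) (y.tStart ℓ) - y.sStart s₀ ℓ)) t
    + (Ico (y.tCheck ℓ) (y.tHat ℓ)).indicator (P.vel (y.target ℓ)) t
    + (Ico (y.tHat ℓ) (y.tEnd ℓ)).indicator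
        (fun _ => Real.sign (y.sEnd ℓ - P.pos (y.target ℓ) (y.tEnd ℓ))) t

lemma phaseControl_of_mem_first (hy : y ∈ P.agentParamSpace n j) (s₀ : ℝ) {ℓ : Fin n} {t : ℝ}
    (ht : t ∈ Ico (y.tStart ℓ) (y.tCheck ℓ)) :
    P.phaseControl s₀ y ℓ t = Real.sign (P.pos (y.target ℓ) (y.tStart ℓ) - y.sStart s₀ ℓ) := by
  obtain ⟨-, h2, -, -⟩ := hy.2 ℓ
  rw [phaseControl, indicator_of_mem ht, indicator_of_notMem, indicator_of_notMem, add_zero,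
    add_zero]
  · exact fun h => absurd (ht.2.trans_le h2) (not_lt.2 h.1)
  · exact fun h => absurd ht.2 (not_lt.2 h.1)

lemma phaseControl_of_mem_middle (s₀ : ℝ) {ℓ : Fin n} {t : ℝ}
    (ht : t ∈ Ico (y.tCheck ℓ) (y.tHat ℓ)) :
    P.phaseControl s₀ y ℓ t = P.vel (y.target ℓ) t := by
  rw [phaseControl, indicator_of_mem ht, indicator_of_notMem, indicator_of_notMem, add_zero,
    zero_add]
  · exact fun h => absurd ht.2 (not_lt.2 h.1)
  · exact fun h => absurd h.2 (not_lt.2 ht.1)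

lemma phaseControl_of_mem_last (hy : y ∈ P.agentParamSpace n j) (s₀ : ℝ) {ℓ : Fin n} {t : ℝ}
    (ht : t ∈ Ico (y.tHat ℓ) (y.tEnd ℓ)) :
    P.phaseControl s₀ y ℓ t = Real.sign (y.sEnd ℓ - P.pos (y.target ℓ) (y.tEnd ℓ)) := by
  obtain ⟨-, h2, -, -⟩ := hy.2 ℓ
  rw [phaseControl, indicator_of_mem ht, indicator_of_notMem, indicator_of_notMem, zero_add,
    zero_add]
  · exact fun h => absurd h.2 (not_lt.2 ht.1)
  · exact fun h => absurd h.2 (not_lt.2 (h2.trans ht.1))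

lemma phaseControl_of_notMem (hy : y ∈ P.agentParamSpace n j) (s₀ : ℝ) {ℓ : Fin n} {t : ℝ}
    (ht : t ∉ Ico (y.tStart ℓ) (y.tEnd ℓ)) : P.phaseControl s₀ y ℓ t = 0 := by
  obtain ⟨h1, h2, h3, -⟩ := hy.2 ℓ
  rw [phaseControl, indicator_of_notMem, indicator_of_notMem, indicator_of_notMem, add_zero,
    add_zero]
  · exact fun h => ht ⟨h1.trans (h2.trans h.1), h.2⟩
  · exact fun h => ht ⟨h1.trans h.1, h.2.trans_le h3⟩
  · exact fun h => ht ⟨h.1, h.2.trans_le (h2.trans h3)⟩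

lemma abs_sign_le_one (x : ℝ) : |Real.sign x| ≤ 1 := by
  rcases Real.sign_apply_eq x with h | h | h <;> simp [h]

lemma abs_phaseControl_le_one (hspeed : ∀ i, ∀ t ∈ Icc 0 P.T, |P.vel i t| ≤ 1)
    (hy : y ∈ P.agentParamSpace n j) (s₀ : ℝ) (ℓ : Fin n) {t : ℝ} (ht : t ∈ Icc 0 P.T) :
    |P.phaseControl s₀ y ℓ t| ≤ 1 := by
  by_cases h : t ∈ Ico (y.tStart ℓ) (y.tEnd ℓ)
  · rcases lt_or_ge t (y.tCheck ℓ) with h1 | h1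
    · rw [phaseControl_of_mem_first hy s₀ ⟨h.1, h1⟩]
      exact abs_sign_le_one _
    rcases lt_or_ge t (y.tHat ℓ) with h2 | h2
    · rw [phaseControl_of_mem_middle s₀ ⟨h1, h2⟩]
      exact hspeed _ t ht
    · rw [phaseControl_of_mem_last hy s₀ ⟨h2, h.2⟩]
      exact abs_sign_le_one _
  · rw [phaseControl_of_notMem hy s₀ h, abs_zero]
    exact zero_le_one

/-- The phases are pairwise disjoint, so that in each phase only its own part contributes. -/
lemma sum_phaseControl (hy : y ∈ P.agentParamSpace n j) (s₀ : ℝ) {ℓ : Fin n} {t : ℝ}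
    (ht : t ∈ Ico (y.tStart ℓ) (y.tEnd ℓ)) :
    ∑ k, P.phaseControl s₀ y k t = P.phaseControl s₀ y ℓ t := by
  refine Finset.sum_eq_single ℓ (fun k _ hk => phaseControl_of_notMem hy s₀ fun hkt => ?_) (by simp)
  have key : ∀ {k k' : Fin n}, k < k' → y.tEnd k ≤ y.tStart k' := fun {k k'} h => by
    rw [← y.knots_succ, ← y.knots_castSucc]
    exact monotone_knots hy (Fin.succ_le_castSucc_iff.2 h)
  rcases lt_or_gt_of_ne hk with h | h
  · exact absurd (hkt.2.trans_le (key h)) (not_lt.2 ht.1)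
  · exact absurd (ht.2.trans_le (key h)) (not_lt.2 hkt.1)

lemma aemeasurable_phaseControl (s₀ : ℝ) (ℓ : Fin n) :
    AEMeasurable (P.phaseControl s₀ y ℓ) (volume.restrict (Icc 0 P.T)) := by
  have hv : AEMeasurable (P.vel (y.target ℓ)) (volume.restrict (Icc 0 P.T)) := by
    rw [← Measure.restrict_congr_set Ioc_ae_eq_Icc]
    exact (P.vel_integrable _).1.aestronglyMeasurable.aemeasurable
  exact ((aemeasurable_const.indicator measurableSet_Ico).add
    (hv.indicator measurableSet_Ico)).add (aemeasurable_const.indicator measurableSet_Ico)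

theorem mapsTo_paramControl (hspeed : ∀ i, ∀ t ∈ Icc 0 P.T, |P.vel i t| ≤ 1) :
    MapsTo (P.paramControl n) (P.paramSpace n) P.admissible := by
  intro π hπ j
  have hsum : ∀ t, P.paramControl n π j t = ∑ ℓ, P.phaseControl (P.s₀ j) (π j) ℓ t := fun t => rfl
  refine ⟨?_, fun t ht => ?_⟩
  · exact Finset.aemeasurable_fun_sum (f := fun ℓ => P.phaseControl (P.s₀ j) (π j) ℓ) _
      fun ℓ _ => aemeasurable_phaseControl _ ℓ
  · rw [hsum]
    by_cases h : ∃ ℓ, t ∈ Ico ((π j).tStart ℓ) ((π j).tEnd ℓ)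
    · obtain ⟨ℓ, hℓ⟩ := h
      rw [sum_phaseControl (hπ j) _ hℓ]
      exact abs_phaseControl_le_one hspeed (hπ j) _ ℓ ht
    · push Not at h
      rw [Finset.sum_eq_zero fun ℓ _ => phaseControl_of_notMem (hπ j) _ (h ℓ), abs_zero]
      exact zero_le_one

end ParamSpace

/-! ### Agent and target trajectories -/

section Trajectories

variable {N M : ℕ} {P : MonitoringProblem N M}

lemma intervalIntegrable_of_admissible {u : Fin N → ℝ → ℝ} (hu : u ∈ P.admissible) (j : Fin N)
    {x y : ℝ} (hx : x ∈ Icc 0 P.T) (hy : y ∈ Icc 0 P.T) :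
    IntervalIntegrable (u j) volume x y := by
  have h : IntegrableOn (u j) (Icc 0 P.T) :=
    Integrable.of_bound (hu j).1.aestronglyMeasurable 1
      ((ae_restrict_iff' measurableSet_Icc).2 (ae_of_all _ (hu j).2))
  exact (h.mono_set (uIcc_subset_Icc hx hy)).intervalIntegrable

lemma agentPos_sub {u : Fin N → ℝ → ℝ} (hu : u ∈ P.admissible) (j : Fin N)
    {x y : ℝ} (hx : x ∈ Icc 0 P.T) (hy : y ∈ Icc 0 P.T) :
    P.agentPos u j y - P.agentPos u j x = ∫ τ in x..y, u j τ := by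
  have h0 : (0 : ℝ) ∈ Icc 0 P.T := ⟨le_rfl, P.T_pos.le⟩
  rw [agentPos, agentPos, add_sub_add_left_eq_sub, intervalIntegral.integral_interval_sub_left
    (intervalIntegrable_of_admissible hu j h0 hy) (intervalIntegrable_of_admissible hu j h0 hx)]

lemma abs_agentPos_sub_le {u : Fin N → ℝ → ℝ} (hu : u ∈ P.admissible) (j : Fin N) :
    ∀ x ∈ Icc 0 P.T, ∀ y ∈ Icc 0 P.T, |P.agentPos u j x - P.agentPos u j y| ≤ |x - y| := by
  intro x hx y hy
  rw [agentPos_sub hu j hy hx]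
  have := intervalIntegral.norm_integral_le_of_norm_le_const (a := y) (b := x) (f := u j) (C := 1)
    fun τ hτ => (hu j).2 τ (uIcc_subset_Icc hy hx (uIoc_subset_uIcc hτ))
  simpa using this

lemma agentPos_zero (u : Fin N → ℝ → ℝ) (j : Fin N) : P.agentPos u j 0 = P.s₀ j := by
  simp [agentPos]

lemma pos_sub (i : Fin M) {x y : ℝ} (hx : x ∈ Icc 0 P.T) (hy : y ∈ Icc 0 P.T) :
    P.pos i y - P.pos i x = ∫ τ in x..y, P.vel i τ := by
  have h : ∀ {z}, z ∈ Icc 0 P.T → IntervalIntegrable (P.vel i) volume 0 z := fun {z} hz => by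
    refine (P.vel_integrable i).mono_set ?_
    rw [uIcc_of_le P.T_pos.le]
    exact uIcc_subset_Icc ⟨le_rfl, P.T_pos.le⟩ hz
  rw [P.pos_eq i y hy, P.pos_eq i x hx, add_sub_add_left_eq_sub,
    intervalIntegral.integral_interval_sub_left (h hy) (h hx)]

lemma abs_pos_sub_le (hspeed : ∀ i, ∀ t ∈ Icc 0 P.T, |P.vel i t| ≤ 1) (i : Fin M) :
    ∀ x ∈ Icc 0 P.T, ∀ y ∈ Icc 0 P.T, |P.pos i x - P.pos i y| ≤ |x - y| := by
  intro x hx y hy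
  rw [pos_sub i hy hx]
  have := intervalIntegral.norm_integral_le_of_norm_le_const (a := y) (b := x) (f := P.vel i)
    (C := 1) fun τ hτ => hspeed i τ (uIcc_subset_Icc hy hx (uIoc_subset_uIcc hτ))
  simpa using this

/-- The trajectory of an agent in a phase: full speed, motion parallel to the target, full speed. -/
theorem agentPos_paramControl (hspeed : ∀ i, ∀ t ∈ Icc 0 P.T, |P.vel i t| ≤ 1) {n : ℕ}
    {π : Fin N → AgentParam M n} (hπ : π ∈ P.paramSpace n) (j : Fin N) (ℓ : Fin n) :
    (∀ t ∈ Icc ((π j).tStart ℓ) ((π j).tCheck ℓ),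
      P.agentPos (P.paramControl n π) j t = P.agentPos (P.paramControl n π) j ((π j).tStart ℓ) +
        Real.sign (P.pos ((π j).target ℓ) ((π j).tStart ℓ) - (π j).sStart (P.s₀ j) ℓ) *
          (t - (π j).tStart ℓ)) ∧
    (∀ t ∈ Icc ((π j).tCheck ℓ) ((π j).tHat ℓ),
      P.agentPos (P.paramControl n π) j t = P.agentPos (P.paramControl n π) j ((π j).tCheck ℓ) +
        (P.pos ((π j).target ℓ) t - P.pos ((π j).target ℓ) ((π j).tCheck ℓ))) ∧
    (∀ t ∈ Icc ((π j).tHat ℓ) ((π j).tEnd ℓ),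
      P.agentPos (P.paramControl n π) j t = P.agentPos (P.paramControl n π) j ((π j).tHat ℓ) +
        Real.sign ((π j).sEnd ℓ - P.pos ((π j).target ℓ) ((π j).tEnd ℓ)) *
          (t - (π j).tHat ℓ)) := by
  have hu := mapsTo_paramControl hspeed hπ
  have hy := hπ j
  obtain ⟨h1, h2, h3, -⟩ := hy.2 ℓ
  obtain ⟨h4, -⟩ := tStart_mem_Icc hy ℓ
  obtain ⟨-, h5⟩ := tEnd_mem_Icc hy ℓ
  have hI : ∀ {t}, (π j).tStart ℓ ≤ t → t ≤ (π j).tEnd ℓ → t ∈ Icc 0 P.T := fun ha hb =>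
    ⟨h4.trans ha, hb.trans h5⟩
  have hsum : ∀ t ∈ Ico ((π j).tStart ℓ) ((π j).tEnd ℓ),
      P.paramControl n π j t = P.phaseControl (P.s₀ j) (π j) ℓ t := fun t ht =>
    sum_phaseControl hy _ ht
  refine ⟨fun t ht => ?_, fun t ht => ?_, fun t ht => ?_⟩
  · have : EqOn (P.paramControl n π j) (fun _ => Real.sign (P.pos ((π j).target ℓ)
        ((π j).tStart ℓ) - (π j).sStart (P.s₀ j) ℓ)) (Ioo ((π j).tStart ℓ) t) := fun x hx => by
      have hx' : x < (π j).tCheck ℓ := hx.2.trans_le ht.2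
      rw [hsum x ⟨hx.1.le, hx'.trans_le (h2.trans h3)⟩]
      exact phaseControl_of_mem_first hy _ ⟨hx.1.le, hx'⟩
    rw [← sub_eq_iff_eq_add', agentPos_sub hu j (hI le_rfl (h1.trans (h2.trans h3)))
      (hI ht.1 (ht.2.trans (h2.trans h3))),
      intervalIntegral.integral_congr_Ioo_of_le ht.1 this, intervalIntegral.integral_const,
      smul_eq_mul, mul_comm]
  · have : EqOn (P.paramControl n π j) (P.vel ((π j).target ℓ)) (Ioo ((π j).tCheck ℓ) t) :=
      fun x hx => by
      have hx' : x < (π j).tHat ℓ := hx.2.trans_le ht.2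
      rw [hsum x ⟨h1.trans hx.1.le, hx'.trans_le h3⟩]
      exact phaseControl_of_mem_middle _ ⟨hx.1.le, hx'⟩
    have hc := hI h1 (h2.trans h3)
    have ht' := hI (h1.trans ht.1) (ht.2.trans h3)
    rw [← sub_eq_iff_eq_add', agentPos_sub hu j hc ht', pos_sub _ hc ht',
      intervalIntegral.integral_congr_Ioo_of_le ht.1 this]
  · have : EqOn (P.paramControl n π j) (fun _ => Real.sign ((π j).sEnd ℓ -
        P.pos ((π j).target ℓ) ((π j).tEnd ℓ))) (Ioo ((π j).tHat ℓ) t) := fun x hx => by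
      have hx' : x < (π j).tEnd ℓ := hx.2.trans_le ht.2
      rw [hsum x ⟨h1.trans (h2.trans hx.1.le), hx'⟩]
      exact phaseControl_of_mem_last hy _ ⟨hx.1.le, hx'⟩
    rw [← sub_eq_iff_eq_add', agentPos_sub hu j (hI (h1.trans h2) h3)
      (hI (h1.trans (h2.trans ht.1)) ht.2),
      intervalIntegral.integral_congr_Ioo_of_le ht.1 this, intervalIntegral.integral_const,
      smul_eq_mul, mul_comm]

end Trajectories

/-! ### Improving a trajectory by a parameterized control -/

section Improvement

variable {N M : ℕ} {P : MonitoringProblem N M} {Δ : ℝ}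

/-- Changing the observed target takes time more than `Δ / 2`, since both the agent and the targets
have speed at most one. -/
lemma eq_of_visible (hP : P.Assumptions Δ) {j : Fin N} {f : ℝ → ℝ}
    (hf : ∀ x ∈ Icc 0 P.T, ∀ y ∈ Icc 0 P.T, |f x - f y| ≤ |x - y|) {x y : ℝ}
    (hx : x ∈ Icc 0 P.T) (hy : y ∈ Icc 0 P.T) (hxy : |x - y| ≤ Δ / 2) {i₁ i₂ : Fin M}
    (h₁ : |P.pos i₁ x - f x| < P.r j) (h₂ : |P.pos i₂ y - f y| < P.r j) : i₁ = i₂ := by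
  by_contra hne
  have hsep := hP.separated i₁ i₂ hne x hx j
  have h3 := hf x hx y hy
  have h4 := abs_pos_sub_le hP.speed i₂ x hx y hy
  have h5 : |P.pos i₁ x - P.pos i₂ x| ≤ |P.pos i₁ x - f x| + |f x - f y| + |P.pos i₂ y - f y|
      + |P.pos i₂ x - P.pos i₂ y| := by
    calc |P.pos i₁ x - P.pos i₂ x|
        = |(P.pos i₁ x - f x) + (f x - f y) - (P.pos i₂ y - f y) - (P.pos i₂ x - P.pos i₂ y)| := by
          ring_nf
      _ ≤ _ := (abs_sub _ _).trans (add_le_add_left ((abs_sub _ _).trans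
          (add_le_add_left (abs_add_le _ _) _)) _)
  linarith

lemma finCons_eq_apply {α : Type*} {n : ℕ} (g : ℕ → α) (k : Fin (n + 1)) :
    (Fin.cons (g 0) (fun ℓ : Fin n => g (ℓ + 1)) : Fin (n + 1) → α) k = g k := by
  refine Fin.cases ?_ (fun i => ?_) k <;> simp

lemma numPhases_pos (hΔ : 0 < Δ) : 0 < P.numPhases Δ :=
  Nat.ceil_pos.2 (div_pos (mul_pos two_pos P.T_pos) hΔ)

lemma phaseLength_le (hΔ : 0 < Δ) : P.T / P.numPhases Δ ≤ Δ / 2 := by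
  have h : 2 * P.T / Δ ≤ P.numPhases Δ := Nat.le_ceil _
  have hn : (0 : ℝ) < P.numPhases Δ := Nat.cast_pos.2 (numPhases_pos hΔ)
  rw [div_le_iff₀ hΔ] at h
  rw [div_le_iff₀ hn]
  linarith

/-- Every agent trajectory can be replaced by a parameterized one which is closer to every target
whenever that target is observed.  On each of the phases of equal length `T / n ≤ Δ / 2` at most one
target is observed, and the trajectory is replaced with respect to that target, keeping the
positions at the ends of the phases. -/
theorem exists_agentParam (hM : 0 < M) (hΔ : 0 < Δ) (hP : P.Assumptions Δ) (j : Fin N) {f : ℝ → ℝ}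
    (hf0 : f 0 = P.s₀ j) (hf : ∀ x ∈ Icc 0 P.T, ∀ y ∈ Icc 0 P.T, |f x - f y| ≤ |x - y|) :
    ∃ y ∈ P.agentParamSpace (P.numPhases Δ) j, ∀ π ∈ P.paramSpace (P.numPhases Δ), π j = y →
      ∀ t ∈ Icc 0 P.T, ∀ i, |P.pos i t - f t| < P.r j →
        |P.pos i t - P.agentPos (P.paramControl (P.numPhases Δ) π) j t| ≤ |P.pos i t - f t| := by
  have hn : (0 : ℝ) < P.numPhases Δ := Nat.cast_pos.2 (numPhases_pos hΔ)
  have hlen := phaseLength_le (P := P) hΔ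
  set n := P.numPhases Δ with hn_def
  set h : ℝ := P.T / n with h_def
  have hh : 0 < h := div_pos P.T_pos hn
  have hnh : n * h = P.T := mul_div_cancel₀ _ hn.ne'
  have hk : ∀ k : ℕ, k ≤ n → (k : ℝ) * h ∈ Icc 0 P.T := fun k hkn =>
    ⟨by positivity, by rw [← hnh]; exact mul_le_mul_of_nonneg_right (Nat.cast_le.2 hkn) hh.le⟩
  have hstep : ∀ k : ℕ, ((k + 1 : ℕ) : ℝ) * h = k * h + h := fun k => by push_cast; ring
  have hsub : ∀ ℓ : Fin n, Icc ((ℓ : ℕ) * h) (((ℓ + 1 : ℕ) : ℝ) * h) ⊆ Icc 0 P.T := fun ℓ =>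
    Icc_subset_Icc (hk ℓ ℓ.2.le).1 (hk (ℓ + 1) ℓ.2).2
  -- the only target that may be observed in phase `ℓ`
  have htarget : ∀ ℓ : Fin n, ∃ i : Fin M, ∀ t ∈ Icc ((ℓ : ℕ) * h) (((ℓ + 1 : ℕ) : ℝ) * h),
      ∀ i', |P.pos i' t - f t| < P.r j → i' = i := by
    intro ℓ
    by_cases hvis : ∃ t ∈ Icc ((ℓ : ℕ) * h) (((ℓ + 1 : ℕ) : ℝ) * h), ∃ i, |P.pos i t - f t| < P.r j
    · obtain ⟨x, hx, i, hi⟩ := hvis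
      refine ⟨i, fun t ht i' hi' => eq_of_visible hP hf (hsub ℓ ht) (hsub ℓ hx) ?_ hi' hi⟩
      rw [hstep] at hx ht
      rw [abs_le]
      constructor <;> linarith [hx.1, hx.2, ht.1, ht.2]
    · push Not at hvis
      exact ⟨⟨0, hM⟩, fun t ht i' hi' => absurd hi' (not_lt.2 (hvis t ht i'))⟩
  choose tgt htgt using htarget
  have hswitch := fun ℓ : Fin n => exists_switching_times (s := f) (ϑ := P.pos (tgt ℓ))
    (a := (ℓ : ℕ) * h) (b := ((ℓ + 1 : ℕ) : ℝ) * h) (by rw [hstep]; linarith)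
    (fun x hx y hy => hf x (hsub ℓ hx) y (hsub ℓ hy))
    (fun x hx y hy => abs_pos_sub_le hP.speed _ x (hsub ℓ hx) y (hsub ℓ hy))
  choose c d hac hcd hdb h1 h2 h3 h4 using hswitch
  set y : AgentParam M n :=
    (tgt, fun ℓ => ((ℓ + 1 : ℕ) : ℝ) * h, c, d, fun ℓ => f (((ℓ + 1 : ℕ) : ℝ) * h)) with hy_def
  have knots_eq : ∀ k : Fin (n + 1), (Fin.cons 0 y.tEnd : Fin (n + 1) → ℝ) k = (k : ℕ) * h := by
    intro k
    have := finCons_eq_apply (fun k : ℕ => (k : ℝ) * h) k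
    rwa [Nat.cast_zero, zero_mul] at this
  have start_eq : ∀ ℓ, y.tStart ℓ = (ℓ : ℕ) * h := fun ℓ => knots_eq ℓ.castSucc
  have sStart_eq : ∀ ℓ, y.sStart (P.s₀ j) ℓ = f ((ℓ : ℕ) * h) := by
    intro ℓ
    have := finCons_eq_apply (fun k : ℕ => f ((k : ℝ) * h)) ℓ.castSucc
    rwa [Nat.cast_zero, zero_mul, hf0] at this
  refine ⟨y, ⟨?_, fun ℓ => ⟨?_, hcd ℓ, hdb ℓ, ?_⟩⟩, ?_⟩
  · rw [knots_eq, Fin.val_last, hnh]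
  · rw [start_eq]; exact hac ℓ
  · have := hf _ (hk (ℓ + 1) ℓ.2) 0 ⟨le_rfl, P.T_pos.le⟩
    rw [sub_zero, abs_of_nonneg (hk (ℓ + 1) ℓ.2).1, hf0] at this
    exact this
  intro π hπ hπy
  set p := P.agentPos (P.paramControl n π) j with hp
  have key : ∀ k : ℕ, k ≤ n → p (k * h) = f (k * h) ∧ ∀ t ∈ Icc 0 ((k : ℝ) * h), ∀ i,
      |P.pos i t - f t| < P.r j → |P.pos i t - p t| ≤ |P.pos i t - f t| := by
    intro k
    induction k with
    | zero =>
      intro _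
      have h0 : p 0 = f 0 := by rw [hp, agentPos_zero, hf0]
      simp only [Nat.cast_zero, zero_mul]
      refine ⟨h0, fun t ht i _ => ?_⟩
      rw [le_antisymm ht.2 ht.1, h0]
    | succ k ih =>
      intro hkn
      obtain ⟨ih1, ih2⟩ := ih (k.le_succ.trans hkn)
      have htraj := agentPos_paramControl hP.speed hπ j ⟨k, hkn⟩
      rw [hπy, start_eq, sStart_eq, ← hp] at htraj
      obtain ⟨tr1, tr2, tr3⟩ := htraj
      specialize h1 ⟨k, hkn⟩; specialize h2 ⟨k, hkn⟩
      specialize h3 ⟨k, hkn⟩; specialize h4 ⟨k, hkn⟩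
      have hac := hac ⟨k, hkn⟩
      have hcd := hcd ⟨k, hkn⟩
      have hdb := hdb ⟨k, hkn⟩
      have htgt := htgt ⟨k, hkn⟩
      simp only [ih1] at tr1
      change ∀ t ∈ Icc (c ⟨k, hkn⟩) (d ⟨k, hkn⟩), _ at tr2
      change ∀ t ∈ Icc (d ⟨k, hkn⟩) (((k + 1 : ℕ) : ℝ) * h), _ at tr3
      change ∀ t ∈ Icc ((k : ℝ) * h) (c ⟨k, hkn⟩), _ at tr1
      have pc := tr1 _ ⟨hac, le_rfl⟩
      have tr2' : ∀ t ∈ Icc (c ⟨k, hkn⟩) (d ⟨k, hkn⟩), p t = f (k * h) +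
          Real.sign (P.pos (tgt ⟨k, hkn⟩) (k * h) - f (k * h)) * (c ⟨k, hkn⟩ - k * h) +
          (P.pos (tgt ⟨k, hkn⟩) t - P.pos (tgt ⟨k, hkn⟩) (c ⟨k, hkn⟩)) := fun t ht => by
        rw [tr2 t ht]; congr 1
      have pd := tr2' _ ⟨hcd, le_rfl⟩
      have tr3' : ∀ t ∈ Icc (d ⟨k, hkn⟩) (((k + 1 : ℕ) : ℝ) * h), p t =
          f (((k + 1 : ℕ) : ℝ) * h) - Real.sign (f (((k + 1 : ℕ) : ℝ) * h) -
            P.pos (tgt ⟨k, hkn⟩) (((k + 1 : ℕ) : ℝ) * h)) * (((k + 1 : ℕ) : ℝ) * h - t) :=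
        fun t ht => by
        have e1 := tr3 t ht
        have e2 : p (d ⟨k, hkn⟩) = _ := pd.trans h4
        change p t = p (d ⟨k, hkn⟩) + Real.sign (f (((k + 1 : ℕ) : ℝ) * h) -
            P.pos (tgt ⟨k, hkn⟩) (((k + 1 : ℕ) : ℝ) * h)) * (t - d ⟨k, hkn⟩) at e1
        rw [e1, e2]
        simp only
        ring
      refine ⟨?_, fun t ht i hi => ?_⟩
      · rw [tr3' _ ⟨hdb, le_rfl⟩, sub_self, mul_zero, sub_zero]
      · rcases le_total t (k * h) with htk | htk
        · exact ih2 t ⟨ht.1, htk⟩ i hi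
        obtain rfl : i = tgt ⟨k, hkn⟩ := htgt t ⟨htk, ht.2⟩ i hi
        rw [abs_sub_comm, abs_sub_comm _ (f t)]
        rcases le_total t (c ⟨k, hkn⟩) with htc | htc
        · rw [tr1 t ⟨htk, htc⟩]
          exact h1 t ⟨htk, htc⟩
        rcases le_total t (d ⟨k, hkn⟩) with htd | htd
        · rw [tr2' t ⟨htc, htd⟩]
          exact h2 t ⟨htc, htd⟩
        · rw [tr3' t ⟨htd, ht.2⟩]
          exact h3 t ⟨htd, ht.2⟩
  intro t ht i hi
  refine (key n le_rfl).2 t ?_ i hi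
  rwa [hnh]

end Improvement

/-! ### The uncertainty as a function of the trajectories -/

section Uncertainty

variable {N M : ℕ} {P : MonitoringProblem N M}

/-- The unreflected rate of the uncertainty of target `i` when the agents move along `f`. -/
noncomputable def drift (P : MonitoringProblem N M) (i : Fin M) (f : Fin N → ℝ → ℝ) (t : ℝ) : ℝ :=
  P.A i - P.B i * P.jointMonitoring (P.pos i t) fun j => f j t

/-- The retraction of the line onto the mission interval `[0, T]`. -/
noncomputable def clampTime (P : MonitoringProblem N M) (t : ℝ) : ℝ := max 0 (min P.T t)

/-- The uncertainty of target `i` when the agents move along `f`.  The rate is frozen outside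
`[0, T]`, where nothing is known about the target positions. -/
noncomputable def uncertainty (P : MonitoringProblem N M) (f : Fin N → ℝ → ℝ) (i : Fin M) :
    ℝ → ℝ :=
  reflected (P.R₀ i) fun t => P.drift i f (P.clampTime t)

/-- The trajectories of speed at most one on the whole line that start at the initial positions. -/
def trajectories (P : MonitoringProblem N M) : Set (Fin N → ℝ → ℝ) :=
  {f | ∀ j, f j 0 = P.s₀ j ∧ ∀ x y, |f j x - f j y| ≤ |x - y|}

/-- The trajectory of a control, frozen outside `[0, T]`. -/
noncomputable def frozenPos (P : MonitoringProblem N M) (u : Fin N → ℝ → ℝ) (j : Fin N) (t : ℝ) :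
    ℝ :=
  P.agentPos u j (P.clampTime t)

lemma clampTime_mem (t : ℝ) : P.clampTime t ∈ Icc 0 P.T :=
  ⟨le_max_left _ _, max_le P.T_pos.le (min_le_left _ _)⟩

lemma clampTime_of_mem {t : ℝ} (ht : t ∈ Icc 0 P.T) : P.clampTime t = t := by
  rw [clampTime, min_eq_right ht.2, max_eq_right ht.1]

lemma abs_clampTime_sub_le (x y : ℝ) : |P.clampTime x - P.clampTime y| ≤ |x - y| := by
  simpa [Real.dist_eq, clampTime] using
    ((LipschitzWith.id.const_min P.T).const_max (0 : ℝ)).dist_le_mul x y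

lemma continuous_clampTime : Continuous P.clampTime := by
  unfold clampTime; fun_prop

lemma isUncertainty_iff {u : Fin N → ℝ → ℝ} {R : Fin M → ℝ → ℝ} :
    P.IsUncertainty u R ↔
      ∀ i, IsReflectedSolution P.T (P.R₀ i) (P.drift i (P.agentPos u)) (R i) := by
  have hrate : ∀ i τ, P.uncertaintyRate i (R i τ) (P.pos i τ) (fun j => P.agentPos u j τ) =
      if R i τ = 0 ∧ P.drift i (P.agentPos u) τ < 0 then 0 else P.drift i (P.agentPos u) τ :=
    fun i τ => by simp only [uncertaintyRate, drift, sub_neg]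
  simp only [IsUncertainty, hrate]
  exact forall_congr' fun i => ⟨fun h => ⟨h.1, h.2.1, h.2.2⟩,
    fun h => ⟨h.nonneg, h.integrable, h.eq_integral⟩⟩

lemma frozenPos_mem_trajectories {u : Fin N → ℝ → ℝ} (hu : u ∈ P.admissible) :
    P.frozenPos u ∈ P.trajectories := by
  refine fun j => ⟨?_, fun x y => ?_⟩
  · rw [frozenPos, clampTime_of_mem ⟨le_rfl, P.T_pos.le⟩, agentPos_zero]
  · exact (abs_agentPos_sub_le hu j _ (clampTime_mem x) _ (clampTime_mem y)).trans
      (abs_clampTime_sub_le x y)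

/-- Pointwise convergence of trajectories of bounded speed is locally uniform; equivalently,
evaluation is jointly continuous. -/
lemma continuous_eval_trajectories (j : Fin N) :
    Continuous fun p : P.trajectories × ℝ => (p.1 : Fin N → ℝ → ℝ) j p.2 := by
  refine continuous_iff_continuousAt.2 fun ⟨f₀, t₀⟩ => ?_
  have heval : Continuous fun p : P.trajectories × ℝ => (p.1 : Fin N → ℝ → ℝ) j t₀ :=
    (continuous_apply_apply (ρ := fun _ _ => ℝ) j t₀).comp
      (continuous_subtype_val.comp continuous_fst)
  have h1 : Tendsto (fun p : P.trajectories × ℝ => |p.2 - t₀| + |(p.1 : Fin N → ℝ → ℝ) j t₀ -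
      (f₀ : Fin N → ℝ → ℝ) j t₀|) (𝓝 (f₀, t₀)) (𝓝 0) := by
    have : Continuous fun p : P.trajectories × ℝ => |p.2 - t₀| + |(p.1 : Fin N → ℝ → ℝ) j t₀ -
      (f₀ : Fin N → ℝ → ℝ) j t₀| :=
      (continuous_snd.sub continuous_const).abs.add (heval.sub continuous_const).abs
    simpa using this.tendsto (f₀, t₀)
  refine tendsto_iff_dist_tendsto_zero.2 (squeeze_zero (fun _ => dist_nonneg) (fun p => ?_) h1)
  rw [Real.dist_eq]
  exact (abs_sub_le _ ((p.1 : Fin N → ℝ → ℝ) j t₀) _).trans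
    (add_le_add_left ((p.1.2 j).2 _ _) _)

theorem isCompact_trajectories (P : MonitoringProblem N M) : IsCompact P.trajectories := by
  have hK : IsCompact (univ.pi fun j : Fin N => univ.pi fun t : ℝ =>
      Icc (P.s₀ j - |t|) (P.s₀ j + |t|)) :=
    isCompact_univ_pi fun j => isCompact_univ_pi fun t => isCompact_Icc
  refine hK.of_isClosed_subset ?_ fun f hf j _ t _ => ?_
  · have hset : P.trajectories =
        ⋂ j, ({f | f j 0 = P.s₀ j} ∩ ⋂ x, ⋂ y, {f | |f j x - f j y| ≤ |x - y|}) := by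
      ext f; simp [trajectories]
    rw [hset]
    refine isClosed_iInter fun j => (isClosed_eq (by fun_prop) continuous_const).inter ?_
    exact isClosed_iInter fun x => isClosed_iInter fun y =>
      isClosed_le (by fun_prop) continuous_const
  · have h := abs_le.1 ((hf j).2 t 0)
    rw [(hf j).1, sub_zero] at h
    constructor <;> linarith

lemma continuous_drift (hspeed : ∀ i, ∀ t ∈ Icc 0 P.T, |P.vel i t| ≤ 1) (i : Fin M) :
    Continuous (Function.uncurry fun (f : P.trajectories) (t : ℝ) =>
      P.drift i f (P.clampTime t)) := by
  have hpos : Continuous fun t => P.pos i (P.clampTime t) := by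
    refine (LipschitzWith.of_dist_le_mul (K := 1) fun x y => ?_).continuous
    simpa [Real.dist_eq] using (abs_pos_sub_le hspeed i _ (clampTime_mem x) _
      (clampTime_mem y)).trans (abs_clampTime_sub_le x y)
  have hx : Continuous fun p : P.trajectories × ℝ => P.pos i (P.clampTime p.2) :=
    hpos.comp continuous_snd
  have hs : ∀ j, Continuous fun p : P.trajectories × ℝ =>
      (p.1 : Fin N → ℝ → ℝ) j (P.clampTime p.2) := fun j =>
    (continuous_eval_trajectories j).comp
      (continuous_fst.prodMk (continuous_clampTime.comp continuous_snd))
  refine continuous_const.sub (continuous_const.mul (continuous_const.sub ?_))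
  exact continuous_finsetProd _ fun j _ => continuous_const.sub
    (continuous_const.max (continuous_const.sub ((hx.sub (hs j)).abs.div_const _)))

lemma continuous_uncertainty (hspeed : ∀ i, ∀ t ∈ Icc 0 P.T, |P.vel i t| ≤ 1) (i : Fin M) :
    Continuous (Function.uncurry fun (f : P.trajectories) (t : ℝ) => P.uncertainty f i t) :=
  continuous_reflected (P.R₀ i) (continuous_drift hspeed i)

lemma isReflectedSolution_uncertainty (hspeed : ∀ i, ∀ t ∈ Icc 0 P.T, |P.vel i t| ≤ 1)
    {f : Fin N → ℝ → ℝ} (hf : f ∈ P.trajectories) (i : Fin M) :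
    IsReflectedSolution P.T (P.R₀ i) (P.drift i f) (P.uncertainty f i) := by
  have hc : Continuous fun t => P.drift i f (P.clampTime t) :=
    (continuous_drift hspeed i).comp (f := fun t : ℝ => ((⟨f, hf⟩ : P.trajectories), t))
      (by fun_prop)
  exact (isReflectedSolution_reflected P.T_pos.le (P.R₀_nonneg i) hc).congr P.T_pos.le
    fun t ht => by simp only [clampTime_of_mem ht]

theorem isUncertainty_uncertainty (hspeed : ∀ i, ∀ t ∈ Icc 0 P.T, |P.vel i t| ≤ 1)
    {u : Fin N → ℝ → ℝ} (hu : u ∈ P.admissible) :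
    P.IsUncertainty u (P.uncertainty (P.frozenPos u)) :=
  isUncertainty_iff.2 fun i =>
    (isReflectedSolution_uncertainty hspeed (frozenPos_mem_trajectories hu) i).congr P.T_pos.le
      fun t ht => by simp only [drift, frozenPos, clampTime_of_mem ht]

lemma IsUncertainty.eqOn {u : Fin N → ℝ → ℝ} {R R' : Fin M → ℝ → ℝ} (h : P.IsUncertainty u R)
    (h' : P.IsUncertainty u R') (i : Fin M) : EqOn (R' i) (R i) (Icc 0 P.T) :=
  (isUncertainty_iff.1 h i).eqOn P.T_pos.le (isUncertainty_iff.1 h' i)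

lemma cost_congr {R R' : Fin M → ℝ → ℝ} (h : ∀ i, EqOn (R' i) (R i) (Icc 0 P.T)) :
    P.cost R' = P.cost R := by
  unfold cost
  congr 1
  refine intervalIntegral.integral_congr fun t ht => ?_
  rw [uIcc_of_le P.T_pos.le] at ht
  exact Finset.sum_congr rfl fun i _ => h i ht

/-- Among all trajectories of speed at most one there are optimal ones, by compactness. -/
theorem exists_optimal_trajectory (hspeed : ∀ i, ∀ t ∈ Icc 0 P.T, |P.vel i t| ≤ 1) :
    ∃ f ∈ P.trajectories, ∀ f' ∈ P.trajectories,
      P.cost (P.uncertainty f) ≤ P.cost (P.uncertainty f') := by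
  have hcont : Continuous fun f : P.trajectories => P.cost (P.uncertainty f) := by
    refine continuous_const.mul
      (intervalIntegral.continuous_parametric_intervalIntegral_of_continuous'
        (f := fun (f : P.trajectories) (t : ℝ) => ∑ i, P.uncertainty f i t) ?_ _ _)
    exact continuous_finsetSum _ fun i _ => continuous_uncertainty hspeed i
  have hne : P.trajectories.Nonempty := ⟨fun j _ => P.s₀ j, fun j => ⟨rfl, fun x y => by simp⟩⟩
  obtain ⟨f, hf, hmin⟩ := P.isCompact_trajectories.exists_isMinOn hne
    (f := fun f => P.cost (P.uncertainty f)) (continuousOn_iff_continuous_domRestrict.2 hcont)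
  exact ⟨f, hf, fun f' hf' => hmin hf'⟩

lemma monitoring_le_one {ρ x y : ℝ} (hρ : 0 < ρ) : monitoring ρ x y ≤ 1 :=
  max_le zero_le_one (sub_le_self _ (by positivity))

lemma monitoring_le_monitoring {ρ x y y' : ℝ} (hρ : 0 < ρ)
    (h : |x - y| < ρ → |x - y'| ≤ |x - y|) : monitoring ρ x y ≤ monitoring ρ x y' := by
  rcases lt_or_ge |x - y| ρ with hlt | hge
  · exact max_le_max le_rfl (sub_le_sub_left (div_le_div_of_nonneg_right (h hlt) hρ.le) _)
  · exact max_le (le_max_left _ _)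
      ((sub_nonpos.2 ((one_le_div hρ).2 hge)).trans (le_max_left _ _))

lemma drift_le_drift {f f' : Fin N → ℝ → ℝ} {i : Fin M} {t : ℝ}
    (h : ∀ j, |P.pos i t - f j t| < P.r j → |P.pos i t - f' j t| ≤ |P.pos i t - f j t|) :
    P.drift i f' t ≤ P.drift i f t := by
  have hB : 0 ≤ P.B i := ((P.A_pos i).trans (P.A_lt_B i)).le
  refine sub_le_sub_left (mul_le_mul_of_nonneg_left (sub_le_sub_left ?_ _) hB) _
  exact Finset.prod_le_prod (fun j _ => sub_nonneg.2 (monitoring_le_one (P.r_pos j)))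
    fun j _ => sub_le_sub_left (monitoring_le_monitoring (P.r_pos j) (h j)) _

/-- Trajectories that are closer to every observed target have a smaller cost. -/
theorem cost_le_cost (hspeed : ∀ i, ∀ t ∈ Icc 0 P.T, |P.vel i t| ≤ 1) {f f' : Fin N → ℝ → ℝ}
    (hf : f ∈ P.trajectories) (hf' : f' ∈ P.trajectories)
    (h : ∀ j, ∀ t ∈ Icc 0 P.T, ∀ i, |P.pos i t - f j t| < P.r j →
      |P.pos i t - f' j t| ≤ |P.pos i t - f j t|) :
    P.cost (P.uncertainty f') ≤ P.cost (P.uncertainty f) := by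
  have hc : ∀ {f}, f ∈ P.trajectories →
      IntervalIntegrable (fun t => ∑ i, P.uncertainty f i t) volume 0 P.T := fun {f} hf =>
    (continuous_finsetSum _ fun i _ => (continuous_uncertainty hspeed i).comp
      (f := fun t : ℝ => ((⟨f, hf⟩ : P.trajectories), t)) (by fun_prop)).intervalIntegrable _ _
  refine mul_le_mul_of_nonneg_left ?_ (one_div_nonneg.2 P.T_pos.le)
  refine intervalIntegral.integral_mono_on P.T_pos.le (hc hf') (hc hf) fun t ht => ?_
  exact Finset.sum_le_sum fun i _ =>
    (isReflectedSolution_uncertainty hspeed hf i).le_of_le P.T_pos.le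
      (isReflectedSolution_uncertainty hspeed hf' i)
      (fun τ hτ => drift_le_drift fun j => h j τ hτ i) t ht

end Uncertainty

end MonitoringProblem

open MonitoringProblem in
theorem mainTheorem1 {N M : ℕ} (hM : 0 < M) (P : MonitoringProblem N M)
    (Δ : ℝ) (hΔ : 0 < Δ) (hP : P.Assumptions Δ) :
    -- the cost of every admissible control is well defined
    (∀ u ∈ P.admissible, ∃ R, P.IsUncertainty u R ∧
      ∀ R', P.IsUncertainty u R' → ∀ i, Set.EqOn (R' i) (R i) (Set.Icc 0 P.T)) ∧
    -- the parameter space is compact and parameterizes admissible controls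
    IsCompact (P.paramSpace (P.numPhases Δ)) ∧
    Set.MapsTo (P.paramControl (P.numPhases Δ)) (P.paramSpace (P.numPhases Δ)) P.admissible ∧
    -- some parameter describes an optimal control
    ∃ u, P.IsOptimal u ∧
      ∃ π ∈ P.paramSpace (P.numPhases Δ), P.paramControl (P.numPhases Δ) π = u := by
  refine ⟨fun u hu => ⟨_, isUncertainty_uncertainty hP.speed hu, fun R' hR' i =>
    (isUncertainty_uncertainty hP.speed hu).eqOn hR' i⟩, P.isCompact_paramSpace _,
    mapsTo_paramControl hP.speed, ?_⟩
  obtain ⟨f, hf, hmin⟩ := exists_optimal_trajectory hP.speed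
  choose π hπ hbest using fun j => exists_agentParam hM hΔ hP j (hf j).1
    fun x _ y _ => (hf j).2 x y
  have hu : P.paramControl (P.numPhases Δ) π ∈ P.admissible := mapsTo_paramControl hP.speed hπ
  refine ⟨_, ⟨hu, _, isUncertainty_uncertainty hP.speed hu, fun u' hu' R' hR' => ?_⟩, π, hπ, rfl⟩
  rw [cost_congr fun i => (isUncertainty_uncertainty hP.speed hu').eqOn hR' i]
  refine (cost_le_cost hP.speed hf (frozenPos_mem_trajectories hu) fun j t ht i hi => ?_).trans
    (hmin _ (frozenPos_mem_trajectories hu'))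
  rw [frozenPos, clampTime_of_mem ht]
  exact hbest j π hπ rfl t ht i hi
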